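/- **Proposition 3.2.** Let $k$ be an algebraically closed field, $2\le r\le n-2$, $G=GL_n(k)$, $B\subset G$ the upper triangular matrices, $P_r\supset B$ the maximal parabolic subgroup preserving the span of the first $r$ basis vectors, so that $G/P_r$ is the Grassmannian $G_{r,n}$. Let $T$ be the diagonal torus of $SL_n(k)$, $N$ its normaliser in $SL_n(k)$, $W=N/T=S_n$, with simple reflections $s_j=(j\;\,j+1)$. Let $1\le a_1<a_2<\dots<a_r\le n-1$, let $w=(s_{a_1}\cdots s_1)(s_{a_2}\cdots s_2)\cdots(s_{a_r}\cdots s_r)$ and let $X(w)=\overline{BwP_r/P_r}$. For $1\le i\le r$, $1\le j\le a_i-i+1$ let $c_j$ be the $j$-th positive integer not in $\{a_1+1,\dots,a_r+1\}$, let $\beta_{i,j}=\alpha_{c_j}+\alpha_{c_j+1}+\dots+\alpha_{a_i}$ (these are the positive roots made negative by $w^{-1}$) and let $u_{\beta_{i,j}}(x)=1+xE_{c_j,a_i+1}$ be the corresponding root group elements, which commute with each other. Let $V\subset X(w)$ be the set of points $\prod u_{\beta_{i,j}}(x_{i,j})\,wP_r$ with all $x_{i,j}\ne0$, let $X_{i,j}$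 be the function on $V$ sending this point to $x_{i,j}$, and put $$Y_{i,j}=\frac{X_{i,a_i-i+1}\,X_{i+1,j}}{X_{i,j}\,X_{i+1,a_i-i+1}}\qquad(1\le i\le r-1,\ 1\le j\le a_i-i),$$ with the convention $Y_{i,j}=1$ for $j\ge a_i-i+1$ or $i\ge r$. These are $T$-invariant. Each simple reflection $s$ listed below stabilises $X(w)$, and acts on the $Y_{i,k}$ as follows. Here $s(Y)(x)=Y(g^{-1}x)$ for any representative $g\in N$ of $s$; the set $V\cap gV$ is open and dense in $X(w)$, and the identities hold at all of its points. Unless said otherwise, $Y_{i,k}$ stands for a coordinate with $1\le i\le r-1$, $1\le k\le a_i-i$. 1. If $1\le j\le a_1-2$, then $s_j$ interchanges $Y_{i,j}$ and $Y_{i,j+1}$ for $1\le i\le r-1$ and fixes all other $Y_{i,k}$. 2. If $1\le p\le r-1$ and $a_p+2\le j\le a_{p+1}-2$, then $s_j$ interchanges $Y_{i,j-p}$ and $Y_{i,j-p+1}$ for $p+1\le i\le r-1$ and fixes all other $Y_{i,k}$. 3. Let $1\le p\le r$, with $a_1\ge 2$ if $p=1$ and $a_p\ge a_{p-1}+3$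 if $p\ge2$. (a) $s_{a_p-1}$ fixes $Y_{i,k}$ for $1\le i\le p-1$. (b) If $p\le i\le r-1$ and $a_i-i=a_p-p$, then $s_{a_p-1}(Y_{i,a_p-p})=Y_{i,a_p-p}^{-1}$, and $s_{a_p-1}(Y_{i,k})=Y_{i,k}Y_{i,a_p-p}^{-1}$ for $1\le k<a_p-p$. (c) If $p+1\le i\le r-1$ and $a_i-i>a_p-p$, then $s_{a_p-1}$ interchanges $Y_{i,a_p-p}$ and $Y_{i,a_p-p+1}$ and fixes all other $Y_{i,k}$ (with this $i$). 4. (a) Let $2\le p\le r-1$ and $a_p=a_{p-1}+1$. (i) If $p\ge3$ and $1\le k\le a_{p-2}-p+2$, then $s_{a_p}(Y_{p-2,k})=Y_{p-2,k}\,Y_{p-1,k}\,Y_{p-1,a_{p-2}-p+3}^{-1}$. (ii) If $1\le k\le a_p-p$, then $s_{a_p}(Y_{p-1,k})=Y_{p-1,k}^{-1}$ and $s_{a_p}(Y_{p,k})=Y_{p,k}Y_{p-1,k}$. (iii) $s_{a_p}$ fixes $Y_{i,k}$ for $i\ne p-2,p-1,p$. (b) Let $1\le p\le r-1$, with $a_p\ge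 a_{p-1}+2$ if $p\ge2$. (i) $s_{a_p}$ fixes $Y_{i,k}$ ($1\le i\le r-1$, $1\le k\le a_r$) if $i\le p-1$ or $k\ge a_p-p+1$. (ii) If $1\le k\le a_p-p$, then $s_{a_p}(Y_{p,k})=1-Y_{p,k}$. (iii) If $p+1\le i\le r-1$ and $1\le k\le a_p-p$, then $$s_{a_p}(Y_{i,k})=\frac{1-\prod_{m=p}^{i}\left(Y_{m,k}/Y_{m,a_p-p+1}\right)}{1-\prod_{m=p}^{i-1}\left(Y_{m,k}/Y_{m,a_p-p+1}\right)}\;Y_{i,a_p-p+1},$$ where the denominator does not vanish on $V\cap gV$. (c) (i) If $a_r=a_{r-1}+1$, then $s_{a_r}(Y_{r-2,k})=Y_{r-2,k}\,Y_{r-1,k}\,Y_{r-1,a_{r-2}-r+3}^{-1}$ for $1\le k\le a_{r-2}-r+2$ (when $r\ge3$), $s_{a_r}(Y_{r-1,k})=Y_{r-1,k}^{-1}$ for $1\le k\le a_r-r$, and $s_{a_r}$ fixes $Y_{i,k}$ for $i\ne r-2,r-1$. (ii) If $a_r\ge a_{r-1}+2$, then $s_{a_r}$ fixes all $Y_{i,k}$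 ($1\le i\le r$, $1\le k\le a_r-r+1$). -/

import Mathlib

open scoped MatrixGroups Pointwise Topology

noncomputable section

namespace TorusQuotient

/-- The index in `Fin n` of the `m`-th basis vector, `1 ≤ m ≤ n` (indices are counted from `1`
throughout, as are rows, columns and simple roots). -/
def idx (n : ℕ) [NeZero n] (m : ℕ) : Fin n := Fin.ofNat n (m - 1)

/-! ### Subgroups of `GL_n` and `SL_n` -/

/-- The invertible matrices that are block upper triangular with respect to `b : Fin n → ℕ`. -/
def blockUpper (k : Type*) [Field k] (n : ℕ) (b : Fin n → ℕ) : Subgroup (GL (Fin n) k) where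
  carrier := {g | (g : Matrix (Fin n) (Fin n) k).BlockTriangular b}
  one_mem' := Matrix.blockTriangular_one
  mul_mem' := fun hg hh => Matrix.BlockTriangular.mul hg hh
  inv_mem' := by
    intro g hg
    have : Invertible (g : Matrix (Fin n) (Fin n) k) := g.invertible
    have h := Matrix.blockTriangular_inv_of_blockTriangular (b := b) hg
    simpa [Matrix.coe_units_inv] using h

/-- The Borel subgroup `B` of upper triangular matrices in `GL_n`. -/
def borel (k : Type*) [Field k] (n : ℕ) : Subgroup (GL (Fin n) k) :=
  blockUpper k n fun p => (p : ℕ)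

/-- The maximal parabolic subgroup `P_r` of `GL_n` that contains `B` and is attached to the simple
root `α_r`: the matrices that preserve the span of the first `r` basis vectors. -/
def parabolic (k : Type*) [Field k] (n r : ℕ) : Subgroup (GL (Fin n) k) :=
  blockUpper k n fun p => if (p : ℕ) < r then 0 else 1

/-- The Grassmannian `G_{r,n} = GL_n / P_r`. -/
abbrev Grass (k : Type*) [Field k] (n r : ℕ) : Type _ := GL (Fin n) k ⧸ parabolic k n r

/-- The diagonal maximal torus `T` of `SL_n`. -/
def torus (k : Type*) [Field k] (n : ℕ) : Subgroup (Matrix.SpecialLinearGroup (Fin n) k) where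
  carrier := {t | ∃ d : Fin n → k, (t : Matrix (Fin n) (Fin n) k) = Matrix.diagonal d}
  one_mem' := ⟨fun _ => 1, by simp⟩
  mul_mem' := by
    rintro s t ⟨d, hd⟩ ⟨e, he⟩
    exact ⟨fun i => d i * e i, by simp [hd, he]⟩
  inv_mem' := by
    rintro t ⟨d, hd⟩
    refine ⟨fun i => (Matrix.diagonal d).adjugate i i, ?_⟩
    rw [Matrix.SpecialLinearGroup.coe_inv, hd]
    ext i j
    by_cases h : i = j
    · subst h; simp
    · simp [h, Matrix.adjugate_diagonal]

/-- `g` represents the element `σ` of the Weyl group `W = N / T = S_n`: it lies in the normaliser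
`N` of `T` in `SL_n`, and conjugation by `g` permutes the diagonal entries of the elements of `T`
by `σ`. -/
def Represents {k : Type*} [Field k] {n : ℕ} (g : Matrix.SpecialLinearGroup (Fin n) k)
    (σ : Equiv.Perm (Fin n)) : Prop :=
  g ∈ Subgroup.normalizer (torus k n : Set (Matrix.SpecialLinearGroup (Fin n) k)) ∧
    ∀ t ∈ torus k n, ∀ i : Fin n,
      (g * t * g⁻¹ : Matrix.SpecialLinearGroup (Fin n) k) (σ i) (σ i) = t i i

/-- The simple reflection `s_j`, `1 ≤ j ≤ n - 1`, in `W = S_n`: the transposition of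
`j` and `j + 1`. -/
def simpleRefl (n : ℕ) [NeZero n] (j : ℕ) : Equiv.Perm (Fin n) :=
  Equiv.swap (idx n j) (idx n (j + 1))

/-- The permutation matrix of `σ` in `GL_n`; it sends the basis vector `e_i` to `e_{σ i}`. -/
def permGL (k : Type*) [Field k] {n : ℕ} (σ : Equiv.Perm (Fin n)) : GL (Fin n) k where
  val := (σ⁻¹).permMatrix k
  inv := σ.permMatrix k
  val_inv := by rw [← Matrix.permMatrix_mul]; simp
  inv_val := by rw [← Matrix.permMatrix_mul]; simp

/-! ### Zariski topology -/

/-- The Zariski topology on `GL_n`: the sets `{g | f(g) ≠ 0}`, with `f` a polynomial in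
the matrix entries, form a basis of open sets. -/
abbrev zariskiGL (k : Type*) [Field k] (n : ℕ) : TopologicalSpace (GL (Fin n) k) :=
  TopologicalSpace.generateFrom
    {U | ∃ f : MvPolynomial (Fin n × Fin n) k,
      U = {g : GL (Fin n) k |
        MvPolynomial.eval (fun e => (g : Matrix (Fin n) (Fin n) k) e.1 e.2) f ≠ 0}}

/-- The Zariski topology on `GL_n / P_r`, as the quotient topology. -/
abbrev zariski (k : Type*) [Field k] (n r : ℕ) : TopologicalSpace (Grass k n r) :=
  TopologicalSpace.coinduced (QuotientGroup.mk : GL (Fin n) k → Grass k n r) (zariskiGL k n)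

/-- `U` is a dense open subset of `Z ⊆ GL_n / P_r` (with the subspace topology on `Z`). -/
def IsDenseOpenIn {k : Type*} [Field k] {n r : ℕ} (Z U : Set (Grass k n r)) : Prop :=
  (∃ O : Set (Grass k n r), IsOpen[zariski k n r] O ∧ U = O ∩ Z) ∧ Z ⊆ closure[zariski k n r] U

/-! ### The Schubert variety `X(w)`

Here `a 1 < ⋯ < a r` are the integers that determine the minimal coset representative
`w = (s_{a 1} ⋯ s_1) (s_{a 2} ⋯ s_2) ⋯ (s_{a r} ⋯ s_r)`. -/

/-- The permutation matrix of `(s_{a 1} ⋯ s_2 s_1) ⋯ (s_{a r} ⋯ s_{r+1} s_r)`. -/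
def wElt (k : Type*) [Field k] (n : ℕ) [NeZero n] (r : ℕ) (a : ℕ → ℕ) : GL (Fin n) k :=
  permGL k ((List.range' 1 r).map fun i =>
    (((List.range' i (a i + 1 - i)).reverse).map (simpleRefl n)).prod).prod

/-- The Schubert variety `X(w)`, the Zariski closure of `B w P_r / P_r`. -/
def schubert (k : Type*) [Field k] (n : ℕ) [NeZero n] (r : ℕ) (a : ℕ → ℕ) :
    Set (Grass k n r) :=
  closure[zariski k n r]
    {x | ∃ b ∈ borel k n, x = ((b * wElt k n r a : GL (Fin n) k) : Grass k n r)}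

/-- The `j`-th (`j ≥ 1`) positive integer that is not of the form `a i + 1` with `1 ≤ i ≤ r`. -/
def col (r : ℕ) (a : ℕ → ℕ) (j : ℕ) : ℕ :=
  Nat.nth (fun m => 1 ≤ m ∧ ∀ i, 1 ≤ i → i ≤ r → m ≠ a i + 1) (j - 1)

/-- The element `u_β(x) = 1 + x E_{p,q}` of the root group of the root `β = ε_p - ε_q`, for
`1 ≤ p, q ≤ n` and `p ≠ q`. -/
def rootElt {k : Type*} [Field k] (n : ℕ) [NeZero n] (p q : ℕ) (x : k) : GL (Fin n) k :=
  if h : idx n p ≠ idx n q then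
    (Matrix.SpecialLinearGroup.transvection h x : Matrix.SpecialLinearGroup (Fin n) k)
  else 1

/-- The element `u_{β_{i,j}}(x)`. Here `β_{i,j} = α_c + α_{c+1} + ⋯ + α_{a i} = ε_c - ε_{a i + 1}`
with `c = col r a j`, for `1 ≤ i ≤ r` and `1 ≤ j ≤ a i - i + 1`; these are the positive roots
that `w⁻¹` makes negative. -/
def uElt {k : Type*} [Field k] (n : ℕ) [NeZero n] (r : ℕ) (a : ℕ → ℕ) (i j : ℕ) (x : k) :
    GL (Fin n) k :=
  rootElt n (col r a j) (a i + 1) x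

/-- The point `∏ u_{β_{i,j}}(x_{i,j}) w P_r`. The factors are ordered as
`u_{β_{r,1}} u_{β_{r,2}} ⋯ u_{β_{r,a r - r + 1}} u_{β_{r-1,1}} ⋯ u_{β_{1,a 1}}`. -/
def chart {k : Type*} [Field k] (n : ℕ) [NeZero n] (r : ℕ) (a : ℕ → ℕ) (x : ℕ → ℕ → k) :
    Grass k n r :=
  (((((List.range' 1 r).reverse.map fun i =>
    ((List.range' 1 (a i - i + 1)).map fun j => uElt n r a i j (x i j)).prod).prod *
      wElt k n r a : GL (Fin n) k)) : Grass k n r)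

/-- The subset `V` of `X(w)`: all coordinates `x_{i,j}` are nonzero. -/
def openV (k : Type*) [Field k] (n : ℕ) [NeZero n] (r : ℕ) (a : ℕ → ℕ) : Set (Grass k n r) :=
  {v | ∃ x : ℕ → ℕ → k,
    (∀ i j, 1 ≤ i → i ≤ r → 1 ≤ j → j ≤ a i - i + 1 → x i j ≠ 0) ∧ v = chart n r a x}

/-- The coordinate function `X_{i,j} : ∏ u_{β_{k,l}}(x_{k,l}) w P_r ↦ x_{i,j}`, for `1 ≤ i ≤ r` and
`1 ≤ j ≤ a i - i + 1` (with the junk value `0` outside the cell `B w P_r / P_r`). -/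
def coordX {k : Type*} [Field k] (n : ℕ) [NeZero n] (r : ℕ) (a : ℕ → ℕ) (i j : ℕ) :
    Grass k n r → k :=
  Function.extend (chart n r a) (fun x : ℕ → ℕ → k => x i j) 0

/-- The `T`-invariant function
`Y_{i,j} = (X_{i,a i - i + 1} X_{i+1,j}) / (X_{i,j} X_{i+1,a i - i + 1})` on `V`, for
`1 ≤ i ≤ r - 1` and `1 ≤ j ≤ a i - i`; by convention `Y_{i,j} = 1` for other `i, j`. -/
def coordY {k : Type*} [Field k] (n : ℕ) [NeZero n] (r : ℕ) (a : ℕ → ℕ) (i j : ℕ)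
    (v : Grass k n r) : k :=
  if 1 ≤ i ∧ i < r ∧ 1 ≤ j ∧ j ≤ a i - i then
    (coordX n r a i (a i - i + 1) v * coordX n r a (i + 1) j v) /
      (coordX n r a i j v * coordX n r a (i + 1) (a i - i + 1) v)
  else 1

/-! ### The action of a simple reflection -/

/-- The simple reflection `s_j` stabilises `X(w)`, and its action on the rational functions
`Y_{i,l}` on `X(w)` is described by the formulas `Φ Y sY`, where `Y i l` is the value of `Y_{i,l}`
and `sY i l` is the value of `s_j(Y_{i,l})`, that is, of the function `v ↦ Y_{i,l}(g⁻¹ v)`.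
This is to hold for every representative `g` of `s_j` in `N` and at every point `v` at which
all the `Y_{i,l}` and all the `s_j(Y_{i,l})` are defined, i.e. with `v` and `g⁻¹ v` in `V`; these
points are to form a dense open subset of `X(w)`. -/
def ReflectionActs (k : Type*) [Field k] (n : ℕ) [NeZero n] (r : ℕ) (a : ℕ → ℕ) (j : ℕ)
    (Φ : (Y sY : ℕ → ℕ → k) → Prop) : Prop :=
  ∀ g : Matrix.SpecialLinearGroup (Fin n) k, Represents g (simpleRefl n j) →
    (∀ v : Grass k n r, (g : GL (Fin n) k) • v ∈ schubert k n r a ↔ v ∈ schubert k n r a) ∧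
    IsDenseOpenIn (schubert k n r a)
      {v | v ∈ openV k n r a ∧ (g : GL (Fin n) k)⁻¹ • v ∈ openV k n r a} ∧
    ∀ v : Grass k n r, v ∈ openV k n r a → (g : GL (Fin n) k)⁻¹ • v ∈ openV k n r a →
      Φ (fun i l => coordY n r a i l v)
        (fun i l => coordY n r a i l ((g : GL (Fin n) k)⁻¹ • v))

end TorusQuotient

end

/-! ### Points of the Grassmannian as column spaces, and their Plücker coordinates. -/

namespace TorusQuotient

variable {k : Type*} [Field k] {n r : ℕ}

/-! A point of `G_{r,n}` is the column space of the first `r` columns of a representative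
(`mk_eq_mk_of_frame`, `exists_frame_eq`). The points of the cell `B w P_r / P_r` are the column
spaces of the echelon matrices with a pivot `1` in row `a i + 1` of column `i` and free entries `x i
j` in the nonpivot rows `col r a j` above it (`frame_chart`, `cell_eq_range`). Acting by a matrix
thus means multiplying and restoring the echelon form.

A representative of `s_j` is monomial (`Represents.apply_eq_zero`), hence a permutation matrix times
a diagonal one. The diagonal factor rescales `x i j` by a function of `i` times a function of `j`,
which the cross ratios `Y` do not see (`ratio_scale`). What remains is the exchange of rows `j` and
`j + 1`. If both are nonpivot rows, two second indices are exchanged (`simpleRefl_smul_swapCols`).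
If both are pivot rows, two columns are exchanged (`simpleRefl_smul_swapRows`). If `j = a p` is a
nonpivot row just above the pivot of column `p`, one step of Gaussian elimination with pivot `x p (a
p - p + 1)` restores the echelon form (`simpleRefl_smul_lowerPivot`). The formulas for `Y` are then
algebra; the products in the third case arise from the telescoping identity `prod_ratio_div`.

In each case `V` is carried into the cell, so its closure `X(w)` is stable. Moreover `V` is cut out
of `X(w)` by nonvanishing Plücker coordinates (`openV_eq`) and is dense (`chart_mem_closure_openV`);
with stability this makes `V ∩ gV` open and dense (`isDenseOpenIn`). -/

/-- The first `r` columns of a matrix. -/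
def frame (h : r ≤ n) (g : GL (Fin n) k) : Matrix (Fin n) (Fin r) k :=
  (g : Matrix (Fin n) (Fin n) k).submatrix id (Fin.castLE h)

theorem frame_mul (h : r ≤ n) (g g' : GL (Fin n) k) :
    frame h (g * g') = (g : Matrix (Fin n) (Fin n) k) * frame h g' := by
  ext p i
  simp [frame, Matrix.mul_apply]

theorem frame_one_apply (h : r ≤ n) (p : Fin n) (i : Fin r) :
    frame h (1 : GL (Fin n) k) p i = if (p : ℕ) = i then 1 else 0 := by
  simp [frame, Matrix.one_apply, Fin.ext_iff]

theorem mem_parabolic_iff (h : r ≤ n) (g : GL (Fin n) k) :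
    g ∈ parabolic k n r ↔ ∀ (p : Fin n) (i : Fin r), r ≤ (p : ℕ) → frame h g p i = 0 := by
  constructor
  · intro hg p i hp
    refine hg (i := p) (j := Fin.castLE h i) ?_
    have : ¬ (p : ℕ) < r := not_lt.2 hp
    simp [this]
  · intro hg p q hpq
    by_cases hq : (q : ℕ) < r
    · by_cases hp : (p : ℕ) < r
      · simp [hp, hq] at hpq
      · exact hg p ⟨q, hq⟩ (not_lt.1 hp)
    · by_cases hp : (p : ℕ) < r <;> simp [hp, hq] at hpq

/-- The first `r` columns of `g'⁻¹ * g` are those of the identity times `Q`, so their lower block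
vanishes. Invertibility of `Q` need not be assumed. -/
theorem mk_eq_mk_of_frame (h : r ≤ n) {g g' : GL (Fin n) k} (Q : Matrix (Fin r) (Fin r) k)
    (hQ : frame h g = frame h g' * Q) : (g : Grass k n r) = (g' : Grass k n r) := by
  refine (QuotientGroup.eq.2 ((mem_parabolic_iff h _).2 fun p i hp => ?_)).symm
  have : frame h (g'⁻¹ * g) = frame h (1 : GL (Fin n) k) * Q := by
    rw [frame_mul, hQ, ← Matrix.mul_assoc, ← frame_mul, inv_mul_cancel]
  rw [this, Matrix.mul_apply]
  refine Finset.sum_eq_zero fun m _ => ?_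
  rw [frame_one_apply, if_neg, zero_mul]
  have := m.2
  omega

theorem exists_frame_eq (h : r ≤ n) {g g' : GL (Fin n) k}
    (hg : (g : Grass k n r) = (g' : Grass k n r)) :
    ∃ Q : Matrix (Fin r) (Fin r) k, frame h g = frame h g' * Q := by
  have hp := (mem_parabolic_iff h _).1 (QuotientGroup.eq.1 hg.symm)
  refine ⟨(frame h (g'⁻¹ * g)).submatrix (Fin.castLE h) id, ?_⟩
  have h1 : frame h g = (g' : Matrix (Fin n) (Fin n) k) * frame h (g'⁻¹ * g) := by
    rw [← frame_mul, mul_inv_cancel_left]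
  rw [h1]
  generalize frame h (g'⁻¹ * g) = M at hp
  ext p i
  obtain ⟨s, rfl⟩ := Nat.exists_eq_add_of_le h
  rw [Matrix.mul_apply, Matrix.mul_apply, Fin.sum_univ_add, add_eq_left.2]
  · rfl
  · exact Finset.sum_eq_zero fun q _ => by rw [hp _ _ (by simp), mul_zero]

/-- The change of basis is found in both directions; the two compose to the identity because the
columns of a frame are independent. -/
theorem exists_isUnit_frame_eq (h : r ≤ n) {g g' : GL (Fin n) k}
    (hg : (g : Grass k n r) = (g' : Grass k n r)) :
    ∃ Q : Matrix (Fin r) (Fin r) k, Q.det ≠ 0 ∧ frame h g = frame h g' * Q := by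
  obtain ⟨Q, hQ⟩ := exists_frame_eq h hg
  obtain ⟨Q', hQ'⟩ := exists_frame_eq h hg.symm
  refine ⟨Q, fun h0 => ?_, hQ⟩
  have h1 : frame h (1 : GL (Fin n) k) = frame h (1 : GL (Fin n) k) * (Q' * Q) := by
    have h2 : frame h (g⁻¹ * g) = frame h (g⁻¹ * g) * (Q' * Q) := by
      conv_lhs => rw [frame_mul, hQ, hQ']
      rw [frame_mul]
      simp only [Matrix.mul_assoc]
    simpa using h2
  have h3 : Q' * Q = 1 := by
    ext i j
    have := congrFun (congrFun h1 (Fin.castLE h i)) j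
    rw [Matrix.mul_apply] at this
    simp only [frame_one_apply, Fin.val_castLE, ← Fin.ext_iff, ite_mul, one_mul, zero_mul,
      Finset.sum_ite_eq, Finset.mem_univ, if_true] at this
    rw [← this, Matrix.one_apply]
  have := congrArg Matrix.det h3
  simp [h0] at this

/-- The matrix of the Plücker coordinates of the column space of `frame h g` that belong to the
sets of rows differing from `α` in at most one place. -/
def plucker (h : r ≤ n) (α : Fin r → Fin n) (g : GL (Fin n) k) : Matrix (Fin n) (Fin r) k :=
  frame h g * ((frame h g).submatrix α id).adjugate

/-- Since `adj (S Q) = adj Q * adj S` and `Q * adj Q = det Q`, changing the basis only rescales. The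
adjugate, unlike the inverse, keeps this valid where the pivot minor vanishes and keeps the entries
polynomial. -/
theorem plucker_eq_smul (h : r ≤ n) (α : Fin r → Fin n) {g g' : GL (Fin n) k}
    (hg : (g : Grass k n r) = (g' : Grass k n r)) :
    ∃ δ : k, δ ≠ 0 ∧ plucker h α g = δ • plucker h α g' := by
  obtain ⟨Q, hQ, hQ'⟩ := exists_isUnit_frame_eq h hg
  refine ⟨Q.det, hQ, ?_⟩
  have : (frame h g' * Q).submatrix α id = (frame h g').submatrix α id * Q := by
    ext; simp [Matrix.mul_apply]
  rw [plucker, hQ', this, Matrix.adjugate_mul_distrib, Matrix.mul_assoc, ← Matrix.mul_assoc Q,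
    Matrix.mul_adjugate, Matrix.smul_mul, Matrix.one_mul, Matrix.mul_smul, plucker]

theorem plucker_apply_pivot (h : r ≤ n) (α : Fin r → Fin n) (g : GL (Fin n) k) (i j : Fin r) :
    plucker h α g (α i) j = if i = j then ((frame h g).submatrix α id).det else 0 := by
  have := congrFun (congrFun (Matrix.mul_adjugate ((frame h g).submatrix α id)) i) j
  rw [Matrix.smul_apply, Matrix.one_apply, smul_eq_mul, mul_ite, mul_one, mul_zero] at this
  rw [← this]
  simp [plucker, Matrix.mul_apply]

theorem mk_eq_mk_of_plucker (h : r ≤ n) (α : Fin r → Fin n) {g g' : GL (Fin n) k} {δ : k}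
    (hd : ((frame h g).submatrix α id).det ≠ 0)
    (hg : plucker h α g = δ • frame h g') : (g : Grass k n r) = (g' : Grass k n r) := by
  refine mk_eq_mk_of_frame h ((((frame h g).submatrix α id).det⁻¹ * δ) •
    (frame h g).submatrix α id) ?_
  have := congrArg (· * (frame h g).submatrix α id) hg
  simp only [plucker, Matrix.mul_assoc, Matrix.adjugate_mul, Matrix.smul_mul, Matrix.mul_smul,
    Matrix.mul_one] at this
  rw [Matrix.mul_smul, mul_smul, ← this, smul_smul, inv_mul_cancel₀ hd, one_smul]

/-! ### Zariski topology -/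

theorem isOpen_zariskiGL (f : MvPolynomial (Fin n × Fin n) k) :
    IsOpen[zariskiGL k n] {g : GL (Fin n) k |
      MvPolynomial.eval (fun e : Fin n × Fin n => (g : Matrix (Fin n) (Fin n) k) e.1 e.2) f ≠ 0} :=
  TopologicalSpace.isOpen_generateFrom_of_mem ⟨f, rfl⟩

/-- The generating sets already form a basis: the nonvanishing loci of two polynomials meet in that
of their product. -/
theorem exists_basic_open {O : Set (GL (Fin n) k)} (hO : IsOpen[zariskiGL k n] O)
    {g : GL (Fin n) k} (hg : g ∈ O) :
    ∃ f : MvPolynomial (Fin n × Fin n) k,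
      MvPolynomial.eval (fun e : Fin n × Fin n => (g : Matrix (Fin n) (Fin n) k) e.1 e.2) f ≠ 0 ∧
      ∀ g' : GL (Fin n) k,
        MvPolynomial.eval (fun e => (g' : Matrix (Fin n) (Fin n) k) e.1 e.2) f ≠ 0 → g' ∈ O := by
  induction hO with
  | basic s hs =>
    obtain ⟨f, rfl⟩ := hs
    exact ⟨f, hg, fun _ h => h⟩
  | univ => exact ⟨1, by simp, fun _ _ => trivial⟩
  | inter s t _ _ hs ht =>
    obtain ⟨f, hf, hf'⟩ := hs hg.1
    obtain ⟨f₂, hf₂, hf₂'⟩ := ht hg.2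
    refine ⟨f * f₂, by simp [hf, hf₂], fun g' h => ?_⟩
    rw [map_mul] at h
    exact ⟨hf' _ (left_ne_zero_of_mul h), hf₂' _ (right_ne_zero_of_mul h)⟩
  | sUnion S _ hS =>
    obtain ⟨s, hs, hgs⟩ := hg
    obtain ⟨f, hf, hf'⟩ := hS s hs hgs
    exact ⟨f, hf, fun g' h => ⟨s, hs, hf' g' h⟩⟩

/-- Left multiplication substitutes linear forms for the entries, so it pulls polynomials back to
polynomials. -/
theorem continuous_mul_left_zariskiGL (g : GL (Fin n) k) :
    Continuous[zariskiGL k n, zariskiGL k n] (g * ·) := by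
  refine continuous_generateFrom_iff.2 ?_
  rintro _ ⟨f, rfl⟩
  convert isOpen_zariskiGL (MvPolynomial.aeval (fun e : Fin n × Fin n =>
    ∑ q, MvPolynomial.C ((g : Matrix (Fin n) (Fin n) k) e.1 q) * MvPolynomial.X (q, e.2)) f)
    using 1
  ext g'
  simp only [Set.mem_preimage, Set.mem_ofPred_eq]
  have hb := MvPolynomial.eval₂Hom_bind₁ (RingHom.id k)
    (fun e : Fin n × Fin n => (g' : Matrix (Fin n) (Fin n) k) e.1 e.2)
    (fun e : Fin n × Fin n =>
      ∑ q, MvPolynomial.C ((g : Matrix (Fin n) (Fin n) k) e.1 q) * MvPolynomial.X (q, e.2)) f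
  refine not_congr (Eq.congr_left (Eq.trans
    (congrArg (fun v => MvPolynomial.eval v f) (funext fun e => ?_)) hb.symm))
  simp [Matrix.mul_apply]

theorem continuous_smul_zariski (g : GL (Fin n) k) :
    Continuous[zariski k n r, zariski k n r] (g • · : Grass k n r → Grass k n r) := by
  let _ := zariskiGL k n
  let _ := zariski k n r
  refine continuous_coinduced_dom.2 ?_
  exact (continuous_coinduced_rng (f := (QuotientGroup.mk : GL (Fin n) k → Grass k n r))).comp
    (continuous_mul_left_zariskiGL g)

/-- The formula is carried out on the generic matrix and then evaluated, as adjugates commute with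
ring homomorphisms. -/
theorem exists_polynomial_plucker (h : r ≤ n) (α : Fin r → Fin n) (p : Fin n) (i : Fin r) :
    ∃ f : MvPolynomial (Fin n × Fin n) k, ∀ g : GL (Fin n) k,
      MvPolynomial.eval (fun e : Fin n × Fin n => (g : Matrix (Fin n) (Fin n) k) e.1 e.2) f =
        plucker h α g p i := by
  let M : Matrix (Fin n) (Fin r) (MvPolynomial (Fin n × Fin n) k) :=
    Matrix.of fun p i => MvPolynomial.X (p, Fin.castLE h i)
  refine ⟨(M * (M.submatrix α id).adjugate) p i, fun g => ?_⟩
  set φ := MvPolynomial.eval (fun e : Fin n × Fin n => (g : Matrix (Fin n) (Fin n) k) e.1 e.2) with hφ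
  have hM : M.map φ = frame h g := by ext; simp [M, φ, frame]
  have hA : (φ.mapMatrix (M.submatrix α id).adjugate) =
      ((frame h g).submatrix α id).adjugate := by
    rw [RingHom.map_adjugate, ← hM]; rfl
  rw [plucker, ← hA, ← hM, Matrix.mul_apply, Matrix.mul_apply, map_sum]
  simp

/-- The points with a given Plücker coordinate nonzero. -/
def pluckerOpen (h : r ≤ n) (α : Fin r → Fin n) (p : Fin n) (i : Fin r) : Set (Grass k n r) :=
  {v | ∃ g : GL (Fin n) k, (g : Grass k n r) = v ∧ plucker h α g p i ≠ 0}

theorem mk_mem_pluckerOpen_iff (h : r ≤ n) (α : Fin r → Fin n) (p : Fin n) (i : Fin r)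
    (g : GL (Fin n) k) : (g : Grass k n r) ∈ pluckerOpen h α p i ↔ plucker h α g p i ≠ 0 := by
  constructor
  · rintro ⟨g', hg', hne⟩
    obtain ⟨δ, -, hδ⟩ := plucker_eq_smul h α hg'
    rw [hδ, Matrix.smul_apply, smul_eq_mul] at hne
    exact right_ne_zero_of_mul hne
  · exact fun hne => ⟨g, rfl, hne⟩

theorem isOpen_pluckerOpen (h : r ≤ n) (α : Fin r → Fin n) (p : Fin n) (i : Fin r) :
    IsOpen[zariski k n r] (pluckerOpen (k := k) h α p i) := by
  rw [isOpen_coinduced]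
  obtain ⟨f, hf⟩ := exists_polynomial_plucker (k := k) h α p i
  convert isOpen_zariskiGL f using 1
  ext g
  rw [Set.mem_preimage, mk_mem_pluckerOpen_iff, Set.mem_ofPred_eq, hf]

end TorusQuotient

namespace TorusQuotient

/-! ### Indices -/

/-- The integers `a 1 < ⋯ < a r ≤ n - 1` determine a minimal coset representative. -/
structure Admissible (n r : ℕ) (a : ℕ → ℕ) : Prop where
  le_apply : ∀ i, 1 ≤ i → i ≤ r → i ≤ a i
  apply_add_le : ∀ i j, 1 ≤ i → i ≤ j → j ≤ r → a i + j ≤ a j + i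
  apply_lt : ∀ i, 1 ≤ i → i ≤ r → a i + 1 ≤ n

/-- Strict increase of integers makes `a i - i` weakly increasing; `apply_add_le` states this
without truncated subtraction. -/
theorem Admissible.of_lt {n r : ℕ} {a : ℕ → ℕ} (hn : 1 ≤ n) (ha_first : 1 ≤ a 1)
    (ha_last : a r ≤ n - 1) (ha_mono : ∀ i, 1 ≤ i → i < r → a i < a (i + 1)) :
    Admissible n r a := by
  have key : ∀ i j, 1 ≤ i → i ≤ j → j ≤ r → a i + j ≤ a j + i := by
    intro i j hi hij
    induction j, hij using Nat.le_induction with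
    | base => intro; exact le_rfl
    | succ j hij ih =>
      intro hj
      have := ih (by omega)
      have := ha_mono j (by omega) (by omega)
      omega
  refine ⟨fun i hi hir => ?_, key, fun i hi hir => ?_⟩
  · have := key 1 i le_rfl hi hir
    omega
  · have := key i r hi hir le_rfl
    omega

variable {n r : ℕ} {a : ℕ → ℕ}

theorem Admissible.apply_lt_apply (ha : Admissible n r a) {i j : ℕ} (hi : 1 ≤ i) (hij : i < j)
    (hj : j ≤ r) : a i < a j := by
  have := ha.apply_add_le i j hi hij.le hj
  omega

theorem Admissible.apply_inj (ha : Admissible n r a) {i j : ℕ} (hi : 1 ≤ i) (hir : i ≤ r)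
    (hj : 1 ≤ j) (hjr : j ≤ r) (h : a i = a j) : i = j := by
  rcases lt_trichotomy i j with hij | hij | hij
  · have := ha.apply_lt_apply hi hij hjr; omega
  · exact hij
  · have := ha.apply_lt_apply hj hij hir; omega

theorem Admissible.rank_le (ha : Admissible n r a) (hr : 1 ≤ r) : r ≤ n := by
  have := ha.le_apply r hr le_rfl
  have := ha.apply_lt r hr le_rfl
  omega

theorem Admissible.length_mono (ha : Admissible n r a) {i j : ℕ} (hi : 1 ≤ i) (hij : i ≤ j)
    (hj : j ≤ r) : a i - i + 1 ≤ a j - j + 1 := by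
  have := ha.apply_add_le i j hi hij hj
  have := ha.le_apply i hi (hij.trans hj)
  omega

theorem idx_val [NeZero n] {m : ℕ} (hm : m ≤ n) : (idx n m : ℕ) = m - 1 := by
  have := NeZero.pos n
  simp only [idx, Fin.val_ofNat]
  exact Nat.mod_eq_of_lt (by omega)

theorem idx_succ_val [NeZero n] (p : Fin n) : idx n ((p : ℕ) + 1) = p := by
  ext
  rw [idx_val p.2]
  rfl

theorem idx_inj [NeZero n] {m m' : ℕ} (h1 : 1 ≤ m) (h : m ≤ n) (h1' : 1 ≤ m') (h' : m' ≤ n) :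
    idx n m = idx n m' ↔ m = m' := by
  rw [Fin.ext_iff, idx_val h, idx_val h']
  omega

theorem eq_idx_iff [NeZero n] {m : ℕ} (h1 : 1 ≤ m) (h : m ≤ n) (p : Fin n) :
    p = idx n m ↔ (p : ℕ) + 1 = m := by
  rw [Fin.ext_iff, idx_val h]
  omega

/-! ### The complement of the pivots -/

/-- `m` is a positive integer that is not the index of a pivot row. -/
def NonPivot (r : ℕ) (a : ℕ → ℕ) (m : ℕ) : Prop :=
  1 ≤ m ∧ ∀ i, 1 ≤ i → i ≤ r → m ≠ a i + 1

theorem col_eq_nth (r : ℕ) (a : ℕ → ℕ) (j : ℕ) :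
    col r a j = Nat.nth (NonPivot r a) (j - 1) := rfl

theorem Admissible.infinite_nonPivot (ha : Admissible n r a) :
    (Set.ofPred (NonPivot r a)).Infinite := by
  refine Set.infinite_of_forall_exists_gt fun N => ⟨N + n + 1, ⟨by omega, fun i hi hir => ?_⟩,
    by omega⟩
  have := ha.apply_lt i hi hir
  omega

open Classical in
-- The numbers below `m` are `0`, which accounts for the `+ 1`, the nonpivots, and the pivots, each
-- pivot coming from a single `i`.
theorem Admissible.count_nonPivot_add (ha : Admissible n r a) {m : ℕ} (hm : 1 ≤ m) :
    Nat.count (NonPivot r a) m + ((Finset.Icc 1 r).filter fun i => a i + 1 < m).card + 1 = m := by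
  induction m, hm using Nat.le_induction with
  | base => simp [Nat.count_succ, NonPivot]
  | succ m hm ih =>
    rw [Nat.count_succ]
    by_cases hP : NonPivot r a m
    · have : ((Finset.Icc 1 r).filter fun i => a i + 1 < m + 1) =
          (Finset.Icc 1 r).filter fun i => a i + 1 < m := by
        refine Finset.filter_congr fun i hi => ?_
        rw [Finset.mem_Icc] at hi
        have := hP.2 i hi.1 hi.2
        omega
      rw [this, if_pos hP]
      omega
    · obtain ⟨i, hi, hir, him⟩ : ∃ i, 1 ≤ i ∧ i ≤ r ∧ m = a i + 1 := by
        by_contra hcon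
        push Not at hcon
        exact hP ⟨hm, hcon⟩
      have : ((Finset.Icc 1 r).filter fun i => a i + 1 < m + 1) =
          insert i ((Finset.Icc 1 r).filter fun i => a i + 1 < m) := by
        ext l
        simp only [Finset.mem_filter, Finset.mem_Icc, Finset.mem_insert]
        constructor
        · rintro ⟨hl, hlm⟩
          by_cases hla : a l = a i
          · exact Or.inl (ha.apply_inj hl.1 hl.2 hi hir hla)
          · exact Or.inr ⟨hl, by omega⟩
        · rintro (rfl | ⟨hl, hlm⟩)
          · exact ⟨⟨hi, hir⟩, by omega⟩
          · exact ⟨hl, by omega⟩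
      rw [this, if_neg hP, Finset.card_insert_of_notMem (by simp [him])]
      omega

open Classical in
theorem Admissible.count_nonPivot (ha : Admissible n r a) {m p : ℕ} (hm : 1 ≤ m) (hp : p ≤ r)
    (h1 : ∀ i, 1 ≤ i → i ≤ p → a i + 1 < m) (h2 : ∀ i, p < i → i ≤ r → m ≤ a i + 1) :
    Nat.count (NonPivot r a) m + p + 1 = m := by
  have : ((Finset.Icc 1 r).filter fun i => a i + 1 < m) = Finset.Icc 1 p := by
    ext i
    simp only [Finset.mem_filter, Finset.mem_Icc]
    constructor
    · rintro ⟨hi, him⟩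
      refine ⟨hi.1, not_lt.1 fun hpi => ?_⟩
      have := h2 i hpi hi.2
      omega
    · exact fun hi => ⟨⟨hi.1, by omega⟩, h1 i hi.1 hi.2⟩
  have h := ha.count_nonPivot_add hm
  rwa [this, Nat.card_Icc, Nat.add_sub_cancel] at h

theorem Admissible.col_nonPivot (ha : Admissible n r a) (j : ℕ) : NonPivot r a (col r a j) :=
  Nat.nth_mem_of_infinite ha.infinite_nonPivot _

theorem Admissible.col_inj (ha : Admissible n r a) {i j : ℕ} (hi : 1 ≤ i) (hj : 1 ≤ j) :
    col r a i = col r a j ↔ i = j := by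
  rw [col_eq_nth, col_eq_nth, (Nat.nth_injective ha.infinite_nonPivot).eq_iff]
  omega

theorem exists_col_eq {m : ℕ} (hm : NonPivot r a m) : ∃ j, 1 ≤ j ∧ col r a j = m := by
  classical
  exact ⟨Nat.count (NonPivot r a) m + 1, by omega,
    (col_eq_nth r a _).trans (Nat.nth_count hm)⟩

theorem Admissible.col_sub (ha : Admissible n r a) {m p : ℕ} (hm : NonPivot r a m) (hp : p ≤ r)
    (h1 : ∀ i, 1 ≤ i → i ≤ p → a i + 1 < m) (h2 : ∀ i, p < i → i ≤ r → m ≤ a i + 1) :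
    col r a (m - p) = m := by
  classical
  have h := ha.count_nonPivot hm.1 hp h1 h2
  have : m - p - 1 = Nat.count (NonPivot r a) m := by omega
  rw [col_eq_nth, this]
  exact Nat.nth_count hm

/-- Of the rows `1, …, a i`, exactly `i - 1` are pivots, which leaves `a i - i + 1` nonpivots. Hence
the entries `x i j` fill the nonpivot rows above the pivot of column `i`. -/
theorem Admissible.col_lt_iff (ha : Admissible n r a) {i j : ℕ} (hi : 1 ≤ i) (hir : i ≤ r)
    (hj : 1 ≤ j) : col r a j < a i + 1 ↔ j ≤ a i - i + 1 := by
  classical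
  have h := ha.count_nonPivot (m := a i + 1) (p := i - 1) (by omega) (by omega)
    (fun l hl hli => by have := ha.apply_lt_apply hl (by omega : l < i) hir; omega)
    (fun l hl hlr => by
      have := ha.apply_add_le i l hi (by omega) hlr
      omega)
  have h' := ha.le_apply i hi hir
  have := Nat.count_le_iff_le_nth ha.infinite_nonPivot (a := a i + 1) (b := j - 1)
  rw [col_eq_nth]
  omega

theorem pivot_or_col {m : ℕ} (hm : 1 ≤ m) :
    (∃ i, 1 ≤ i ∧ i ≤ r ∧ m = a i + 1) ∨ ∃ j, 1 ≤ j ∧ m = col r a j := by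
  by_cases hP : NonPivot r a m
  · obtain ⟨j, hj, h⟩ := exists_col_eq hP
    exact Or.inr ⟨j, hj, h.symm⟩
  · left
    by_contra hcon
    push Not at hcon
    exact hP ⟨hm, hcon⟩

/-! ### The permutation `w` -/

theorem simpleRefl_left [NeZero n] (j : ℕ) : simpleRefl n j (idx n j) = idx n (j + 1) :=
  Equiv.swap_apply_left _ _

theorem simpleRefl_right [NeZero n] (j : ℕ) : simpleRefl n j (idx n (j + 1)) = idx n j :=
  Equiv.swap_apply_right _ _

theorem simpleRefl_of_ne [NeZero n] {j q : ℕ} (hj : 1 ≤ j) (hjn : j + 1 ≤ n) (hq : 1 ≤ q)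
    (hqn : q ≤ n) (h1 : q ≠ j) (h2 : q ≠ j + 1) : simpleRefl n j (idx n q) = idx n q := by
  refine Equiv.swap_apply_of_ne_of_ne ?_ ?_
  · rwa [Ne, idx_inj hq hqn hj (by omega)]
  · rwa [Ne, idx_inj hq hqn (by omega) (by omega)]

/-- The cycle `s_{i + m - 1} ⋯ s_{i + 1} s_i`. -/
def ascendingCycle (n : ℕ) [NeZero n] (i m : ℕ) : Equiv.Perm (Fin n) :=
  ((List.range' i m).reverse.map (simpleRefl n)).prod

theorem ascendingCycle_succ [NeZero n] (i m : ℕ) :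
    ascendingCycle n i (m + 1) = simpleRefl n (i + m) * ascendingCycle n i m := by
  simp [ascendingCycle, List.range'_concat]

theorem ascendingCycle_apply [NeZero n] (i m : ℕ) :
    ascendingCycle n i m (idx n i) = idx n (i + m) := by
  induction m with
  | zero => simp [ascendingCycle]
  | succ m ih =>
    rw [ascendingCycle_succ, Equiv.Perm.mul_apply, ih, simpleRefl_left]
    rfl

theorem ascendingCycle_of_ne [NeZero n] {i m q : ℕ} (hi : 1 ≤ i) (him : i + m ≤ n) (hq : 1 ≤ q)
    (hqn : q ≤ n) (h : q < i ∨ i + m < q) : ascendingCycle n i m (idx n q) = idx n q := by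
  induction m with
  | zero => simp [ascendingCycle]
  | succ m ih =>
    rw [ascendingCycle_succ, Equiv.Perm.mul_apply, ih (by omega) (by omega),
      simpleRefl_of_ne (by omega) (by omega) hq hqn (by omega) (by omega)]

/-- The permutation `w` in `S_n`. -/
def wPerm (n : ℕ) [NeZero n] (r : ℕ) (a : ℕ → ℕ) : Equiv.Perm (Fin n) :=
  ((List.range' 1 r).map fun i => ascendingCycle n i (a i + 1 - i)).prod

theorem wElt_eq (k : Type*) [Field k] [NeZero n] : wElt k n r a = permGL k (wPerm n r a) := rfl

theorem wPerm_succ [NeZero n] (t : ℕ) :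
    wPerm n (t + 1) a = wPerm n t a * ascendingCycle n (t + 1) (a (t + 1) + 1 - (t + 1)) := by
  simp [wPerm, List.range'_concat, add_comm 1 t]

theorem Admissible.wPerm_of_lt [NeZero n] (ha : Admissible n r a) {t q : ℕ} (ht : t ≤ r)
    (hq : 1 ≤ q) (hqn : q ≤ n) (h : ∀ i, 1 ≤ i → i ≤ t → a i + 1 < q) :
    wPerm n t a (idx n q) = idx n q := by
  induction t with
  | zero => simp [wPerm]
  | succ t ih =>
    have h1 := ha.apply_lt (t + 1) (by omega) ht
    have h2 := ha.le_apply (t + 1) (by omega) ht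
    have h3 := h (t + 1) (by omega) le_rfl
    rw [wPerm_succ, Equiv.Perm.mul_apply,
      ascendingCycle_of_ne (by omega) (by omega) hq hqn (by omega),
      ih (by omega) fun i hi hit => h i hi (by omega)]

/-- Reading the product from the right, the cycles of index above `i` fix `i`, the `i`-th one
carries it to `a i + 1`, and the earlier ones do not reach that high. -/
theorem Admissible.wPerm_apply [NeZero n] (ha : Admissible n r a) {t i : ℕ} (ht : t ≤ r)
    (hi : 1 ≤ i) (hit : i ≤ t) : wPerm n t a (idx n i) = idx n (a i + 1) := by
  induction t with
  | zero => omega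
  | succ t ih =>
    have h1 := ha.apply_lt (t + 1) (by omega) ht
    have h2 := ha.le_apply (t + 1) (by omega) ht
    rw [wPerm_succ, Equiv.Perm.mul_apply]
    rcases hit.lt_or_eq with hit | rfl
    · rw [ascendingCycle_of_ne (by omega) (by omega) hi (by omega) (by omega),
        ih (by omega) (by omega)]
    · have h4 : t + 1 + (a (t + 1) + 1 - (t + 1)) = a (t + 1) + 1 := by omega
      rw [ascendingCycle_apply, h4, ha.wPerm_of_lt (by omega) (by omega) (by omega)]
      intro l hl hlt
      have := ha.apply_lt_apply hl (by omega : l < t + 1) ht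
      omega

/-! ### The chart in echelon form -/

variable {k : Type*} [Field k]

theorem permGL_apply (σ : Equiv.Perm (Fin n)) (p q : Fin n) :
    (permGL k σ : Matrix (Fin n) (Fin n) k) p q = if p = σ q then 1 else 0 := by
  have : q = σ.symm p ↔ p = σ q := by rw [Equiv.eq_symm_apply, eq_comm]
  simp [permGL, Equiv.Perm.permMatrix, PEquiv.toMatrix_apply, eq_comm, this]

theorem mul_permGL_apply (M : Matrix (Fin n) (Fin n) k) (σ : Equiv.Perm (Fin n)) (p q : Fin n) :
    (M * (permGL k σ : Matrix (Fin n) (Fin n) k)) p q = M p (σ q) := by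
  simp [Matrix.mul_apply, permGL_apply]

theorem permGL_mul_apply {m : Type*} (M : Matrix (Fin n) m k) (σ : Equiv.Perm (Fin n))
    (p : Fin n) (q : m) :
    ((permGL k σ : Matrix (Fin n) (Fin n) k) * M) p q = M (σ⁻¹ p) q := by
  simp [Matrix.mul_apply, permGL_apply, ← Equiv.Perm.inv_eq_iff_eq]

/-- A product of elements `1 + Z` is `1 + ∑ Z` if the products of the `Z` vanish. -/
theorem coe_list_prod_eq_one_add {ι : Type*} (l : List ι) (u : ι → GL (Fin n) k)
    (Z : ι → Matrix (Fin n) (Fin n) k) (hu : ∀ i ∈ l, (u i : Matrix (Fin n) (Fin n) k) = 1 + Z i)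
    (hZ : ∀ i ∈ l, ∀ j ∈ l, Z i * Z j = 0) :
    (((l.map u).prod : GL (Fin n) k) : Matrix (Fin n) (Fin n) k) = 1 + (l.map Z).sum := by
  induction l with
  | nil => simp
  | cons i l ih =>
    have h0 : Z i * (l.map Z).sum = 0 := by
      rw [← List.sum_map_mul_left]
      refine List.sum_eq_zero fun M hM => ?_
      obtain ⟨j, hj, rfl⟩ := List.mem_map.1 hM
      exact hZ i (by simp) j (by simp [hj])
    rw [List.map_cons, List.prod_cons, Units.val_mul, hu i (by simp),
      ih (fun j hj => hu j (by simp [hj])) (fun j hj l hl => hZ j (by simp [hj]) l (by simp [hl])),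
      List.map_cons, List.sum_cons, mul_add, add_mul, add_mul, h0]
    simp [add_assoc]

/-- The sum of the elementary matrices `x_{i,j} E_{c_j, a_i + 1}`. -/
noncomputable def rootSum (n : ℕ) [NeZero n] (r : ℕ) (a : ℕ → ℕ) (x : ℕ → ℕ → k) : Matrix (Fin n) (Fin n) k :=
  ∑ i ∈ Finset.Icc 1 r, ∑ j ∈ Finset.Icc 1 (a i - i + 1),
    Matrix.single (idx n (col r a j)) (idx n (a i + 1)) (x i j)

/-- The product of the root group elements `u_{β_{i,j}}(x_{i,j})`. -/
noncomputable def unipotent (n : ℕ) [NeZero n] (r : ℕ) (a : ℕ → ℕ) (x : ℕ → ℕ → k) : GL (Fin n) k :=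
  ((List.range' 1 r).reverse.map fun i =>
    ((List.range' 1 (a i - i + 1)).map fun j => uElt n r a i j (x i j)).prod).prod

theorem chart_eq_mk [NeZero n] (x : ℕ → ℕ → k) :
    chart n r a x = ((unipotent n r a x * wElt k n r a : GL (Fin n) k) : Grass k n r) := rfl

theorem Admissible.col_le (ha : Admissible n r a) {i j : ℕ} (hi : 1 ≤ i) (hir : i ≤ r)
    (hj : 1 ≤ j) (hji : j ≤ a i - i + 1) : 1 ≤ col r a j ∧ col r a j ≤ n := by
  have h1 := (ha.col_lt_iff hi hir hj).2 hji
  have h2 := ha.apply_lt i hi hir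
  exact ⟨(ha.col_nonPivot j).1, by omega⟩

theorem Admissible.idx_col_ne_idx_pivot [NeZero n] (ha : Admissible n r a) {i j l : ℕ} (hi : 1 ≤ i)
    (hir : i ≤ r) (hj : 1 ≤ j) (hji : j ≤ a i - i + 1) (hl : 1 ≤ l) (hlr : l ≤ r) :
    idx n (col r a j) ≠ idx n (a l + 1) := by
  have h := ha.col_le hi hir hj hji
  rw [Ne, idx_inj h.1 h.2 (by omega) (ha.apply_lt l hl hlr)]
  exact (ha.col_nonPivot j).2 l hl hlr

theorem Admissible.coe_uElt [NeZero n] (ha : Admissible n r a) {i j : ℕ} (hi : 1 ≤ i) (hir : i ≤ r)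
    (hj : 1 ≤ j) (hji : j ≤ a i - i + 1) (x : k) :
    (uElt n r a i j x : Matrix (Fin n) (Fin n) k) =
      1 + Matrix.single (idx n (col r a j)) (idx n (a i + 1)) x := by
  have h := ha.idx_col_ne_idx_pivot hi hir hj hji hi hir
  rw [uElt, rootElt, dif_pos h]
  rfl

theorem list_range'_sum {M : Type*} [AddCommMonoid M] (m : ℕ) (f : ℕ → M) :
    ((List.range' 1 m).map f).sum = ∑ i ∈ Finset.Icc 1 m, f i := by
  rw [← List.sum_toFinset _ List.nodup_range']
  congr 1
  ext
  simp
  omega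

/-- Column indices of the elementary matrices are pivots and row indices are nonpivots, so all
products of two of them vanish. -/
theorem Admissible.coe_unipotent [NeZero n] (ha : Admissible n r a) (x : ℕ → ℕ → k) :
    (unipotent n r a x : Matrix (Fin n) (Fin n) k) = 1 + rootSum n r a x := by
  rw [unipotent, coe_list_prod_eq_one_add _ _ (fun i => ∑ j ∈ Finset.Icc 1 (a i - i + 1),
    Matrix.single (idx n (col r a j)) (idx n (a i + 1)) (x i j))]
  · rw [List.map_reverse, List.sum_reverse, list_range'_sum, rootSum]
  · intro i hi
    simp only [List.mem_reverse, List.mem_range'_1] at hi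
    rw [coe_list_prod_eq_one_add _ _ (fun j =>
      Matrix.single (idx n (col r a j)) (idx n (a i + 1)) (x i j)), list_range'_sum]
    · intro j hj
      simp only [List.mem_range'_1] at hj
      exact ha.coe_uElt hi.1 (by omega) hj.1 (by omega) _
    · intro j hj l hl
      simp only [List.mem_range'_1] at hj hl
      exact Matrix.single_mul_single_of_ne _ _ _ _
        (ha.idx_col_ne_idx_pivot hi.1 (by omega) hl.1 (by omega) hi.1 (by omega)).symm _
  · intro i hi j hj
    simp only [List.mem_reverse, List.mem_range'_1] at hi hj
    rw [Finset.sum_mul_sum]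
    refine Finset.sum_eq_zero fun l hl => Finset.sum_eq_zero fun m hm => ?_
    rw [Finset.mem_Icc] at hl hm
    exact Matrix.single_mul_single_of_ne _ _ _ _
      (ha.idx_col_ne_idx_pivot hj.1 (by omega) hm.1 hm.2 hi.1 (by omega)).symm _

/-- The entry in row `m` and column `i` (counted from `1`) of the echelon matrix with pivot rows
`a 1 + 1, …, a r + 1` and remaining entries `x`. -/
noncomputable def echelon (r : ℕ) (a : ℕ → ℕ) (x : ℕ → ℕ → k) (m i : ℕ) : k :=
  (if m = a i + 1 then 1 else 0) +
    ∑ j ∈ Finset.Icc 1 (a i - i + 1), if m = col r a j then x i j else 0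

theorem Admissible.echelon_pivot (ha : Admissible n r a) (x : ℕ → ℕ → k) {l i : ℕ} (hl : 1 ≤ l)
    (hlr : l ≤ r) (hi : 1 ≤ i) (hir : i ≤ r) :
    echelon r a x (a l + 1) i = if l = i then 1 else 0 := by
  rw [echelon, Finset.sum_eq_zero, add_zero]
  · refine if_congr ⟨fun h => ha.apply_inj hl hlr hi hir (by omega), fun h => by rw [h]⟩ rfl rfl
  · exact fun j _ => if_neg ((ha.col_nonPivot j).2 l hl hlr).symm

theorem Admissible.echelon_col (ha : Admissible n r a) (x : ℕ → ℕ → k) {j i : ℕ} (hj : 1 ≤ j)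
    (hi : 1 ≤ i) (hir : i ≤ r) :
    echelon r a x (col r a j) i = if j ≤ a i - i + 1 then x i j else 0 := by
  rw [echelon, if_neg ((ha.col_nonPivot j).2 i hi hir), zero_add]
  have : ∀ l ∈ Finset.Icc 1 (a i - i + 1), (if col r a j = col r a l then x i l else 0) =
      if j = l then x i l else 0 := fun l hl =>
    if_congr (ha.col_inj hj (Finset.mem_Icc.1 hl).1) rfl rfl
  rw [Finset.sum_congr rfl this, Finset.sum_ite_eq]
  simp [hj]

theorem Admissible.frame_chart [NeZero n] (ha : Admissible n r a) (h : r ≤ n) (x : ℕ → ℕ → k)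
    (p : Fin n) (i : Fin r) :
    frame h (unipotent n r a x * wElt k n r a) p i = echelon r a x (p + 1) (i + 1) := by
  have h1 : wPerm n r a (Fin.castLE h i) = idx n (a (i + 1) + 1) := by
    rw [← ha.wPerm_apply le_rfl (by omega) (by omega), ← idx_succ_val (Fin.castLE h i)]
    rfl
  have hi := ha.apply_lt (i + 1) (by omega) (by omega)
  rw [frame, Matrix.submatrix_apply, Units.val_mul, wElt_eq, mul_permGL_apply, h1,
    ha.coe_unipotent, Matrix.add_apply, Matrix.one_apply, echelon]
  refine congrArg₂ _ (if_congr (eq_idx_iff (by omega) hi _) rfl rfl) ?_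
  rw [rootSum, Matrix.sum_apply, Finset.sum_eq_single ((i : ℕ) + 1)]
  · rw [Matrix.sum_apply]
    refine Finset.sum_congr rfl fun j hj => ?_
    rw [Finset.mem_Icc] at hj
    have hc := ha.col_le (i := i + 1) (by omega) (by omega) hj.1 hj.2
    rw [Matrix.single_apply]
    refine if_congr ?_ rfl rfl
    rw [and_iff_left rfl, eq_comm]
    exact eq_idx_iff hc.1 hc.2 p
  · intro l hl hli
    rw [Finset.mem_Icc] at hl
    rw [Matrix.sum_apply]
    refine Finset.sum_eq_zero fun j hj => ?_
    rw [Matrix.single_apply, if_neg]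
    rintro ⟨-, h2⟩
    rw [idx_inj (by omega) (ha.apply_lt l hl.1 hl.2) (by omega) hi] at h2
    exact hli (ha.apply_inj hl.1 hl.2 (by omega) (by omega) (by omega))
  · intro hi'
    exact absurd (Finset.mem_Icc.2 ⟨by omega, by omega⟩) hi'

end TorusQuotient

namespace TorusQuotient

variable {k : Type*} [Field k] {n r : ℕ} {a : ℕ → ℕ}

/-! ### The open cell and its coordinates -/

/-- The pivot rows of the cell `B w P_r / P_r`. -/
def pivotRow (n : ℕ) [NeZero n] (r : ℕ) (a : ℕ → ℕ) (i : Fin r) : Fin n :=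
  idx n (a (i + 1) + 1)

theorem Admissible.frame_chart_col [NeZero n] (ha : Admissible n r a) (h : r ≤ n) (x : ℕ → ℕ → k)
    {j : ℕ} (hj : 1 ≤ j) (hjn : col r a j ≤ n) (i : Fin r) :
    frame h (unipotent n r a x * wElt k n r a) (idx n (col r a j)) i =
      if j ≤ a (i + 1) - (i + 1) + 1 then x (i + 1) j else 0 := by
  have h1 := (ha.col_nonPivot j).1
  rw [ha.frame_chart, idx_val hjn, Nat.sub_add_cancel h1,
    ha.echelon_col x hj (by omega) (by omega)]

theorem Admissible.frame_chart_pivot [NeZero n] (ha : Admissible n r a) (h : r ≤ n)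
    (x : ℕ → ℕ → k) (l i : Fin r) :
    frame h (unipotent n r a x * wElt k n r a) (pivotRow n r a l) i = if l = i then 1 else 0 := by
  rw [ha.frame_chart, pivotRow, idx_val (ha.apply_lt _ (by omega) (by omega)), Nat.add_sub_cancel,
    ha.echelon_pivot x (by omega) (by omega) (by omega) (by omega)]
  simp [Fin.ext_iff]

theorem Admissible.plucker_chart [NeZero n] (ha : Admissible n r a) (h : r ≤ n)
    (x : ℕ → ℕ → k) :
    plucker h (pivotRow n r a) (unipotent n r a x * wElt k n r a) =
      frame h (unipotent n r a x * wElt k n r a) := by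
  have : (frame h (unipotent n r a x * wElt k n r a)).submatrix (pivotRow n r a) id = 1 := by
    ext l i
    rw [Matrix.submatrix_apply, id, ha.frame_chart_pivot, Matrix.one_apply]
  rw [plucker, this, Matrix.adjugate_one, Matrix.mul_one]

/-- On echelon matrices the Plücker matrix is the frame itself; equal points give proportional
frames, and a pivot entry `1` fixes the scalar. -/
theorem Admissible.chart_inj [NeZero n] (ha : Admissible n r a) {x y : ℕ → ℕ → k}
    (hxy : chart n r a x = chart n r a y) {i j : ℕ} (hi : 1 ≤ i) (hir : i ≤ r) (hj : 1 ≤ j)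
    (hji : j ≤ a i - i + 1) : x i j = y i j := by
  have h := ha.rank_le (hi.trans hir)
  obtain ⟨δ, -, hδ⟩ := plucker_eq_smul h (pivotRow n r a) hxy
  erw [ha.plucker_chart, ha.plucker_chart] at hδ
  have h1 : δ = 1 := by
    have := congrFun (congrFun hδ (pivotRow n r a ⟨i - 1, by omega⟩)) ⟨i - 1, by omega⟩
    rw [Matrix.smul_apply, ha.frame_chart_pivot, ha.frame_chart_pivot] at this
    simpa using this.symm
  have h2 := congrFun (congrFun hδ (idx n (col r a j))) ⟨i - 1, by omega⟩
  have h3 : i - 1 + 1 = i := by omega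
  rw [h1, one_smul, ha.frame_chart_col h _ hj (ha.col_le hi hir hj hji).2,
    ha.frame_chart_col h _ hj (ha.col_le hi hir hj hji).2] at h2
  simpa [h3, hji] using h2

theorem Admissible.coordX_chart [NeZero n] (ha : Admissible n r a) (x : ℕ → ℕ → k) {i j : ℕ}
    (hi : 1 ≤ i) (hir : i ≤ r) (hj : 1 ≤ j) (hji : j ≤ a i - i + 1) :
    coordX n r a i j (chart n r a x) = x i j := by
  have hex : ∃ y : ℕ → ℕ → k, chart n r a y = chart n r a x := ⟨x, rfl⟩
  classical
  rw [coordX, Function.extend_def, dif_pos hex]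
  exact ha.chart_inj (Classical.choose_spec hex) hi hir hj hji

/-- The coordinates of a point of the cell, read off from its Plücker coordinates. -/
noncomputable def cellCoord [NeZero n] (h : r ≤ n) (a : ℕ → ℕ) (g : GL (Fin n) k) (i j : ℕ) : k :=
  if hi : i - 1 < r then
    plucker h (pivotRow n r a) g (idx n (col r a j)) ⟨i - 1, hi⟩ /
      ((frame h g).submatrix (pivotRow n r a) id).det
  else 0

/-- A nonzero pivot minor allows the pivot block to be normalised to the identity; the vanishing of
the entries below the pivots then puts the matrix in echelon form. -/
theorem Admissible.mk_eq_chart [NeZero n] (ha : Admissible n r a) (h : r ≤ n) {g : GL (Fin n) k}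
    (hd : ((frame h g).submatrix (pivotRow n r a) id).det ≠ 0)
    (h0 : ∀ (i : Fin r) (j : ℕ), a (i + 1) - (i + 1) + 1 < j → col r a j ≤ n →
      plucker h (pivotRow n r a) g (idx n (col r a j)) i = 0) :
    (g : Grass k n r) = chart n r a (cellCoord h a g) := by
  refine mk_eq_mk_of_plucker h (pivotRow n r a) hd
    (δ := ((frame h g).submatrix (pivotRow n r a) id).det) ?_
  ext p i
  rcases pivot_or_col (r := r) (a := a) (Nat.succ_pos (p : ℕ)) with ⟨l, hl, hlr, hp⟩ | ⟨j, hj, hp⟩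
  · have h1 : l - 1 + 1 = l := by omega
    have h2 : l - 1 < r := by omega
    have h3 : p = pivotRow n r a ⟨l - 1, h2⟩ := by
      rw [pivotRow, h1, ← idx_succ_val p]
      exact congrArg _ hp
    rw [h3]
    erw [plucker_apply_pivot, Matrix.smul_apply, ha.frame_chart_pivot]
    simp
  · obtain rfl : p = idx n (col r a j) := by
      rw [← hp]
      exact (idx_succ_val p).symm
    have hjn : col r a j ≤ n := by
      rw [← hp]
      exact (idx n (col r a j)).2
    erw [Matrix.smul_apply, ha.frame_chart_col h _ hj hjn]
    split_ifs with hji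
    · simp [cellCoord, mul_div_cancel₀ _ hd]
    · rw [h0 i j (by omega) hjn, smul_zero]

/-- The frame of `b * w` consists of the columns of `b` at the pivot indices, so its pivot block is
upper triangular with nonzero diagonal, and so is its adjugate. -/
theorem Admissible.cell_eq_range [NeZero n] (ha : Admissible n r a) (h : r ≤ n) :
    {x : Grass k n r | ∃ b ∈ borel k n, x = ((b * wElt k n r a : GL (Fin n) k) : Grass k n r)} =
      Set.range (chart n r a) := by
  ext v
  constructor
  · rintro ⟨b, hb, rfl⟩
    have hf : ∀ p i, frame h (b * wElt k n r a) p i =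
        (b : Matrix (Fin n) (Fin n) k) p (pivotRow n r a i) := by
      intro p i
      have h1 : wPerm n r a (Fin.castLE h i) = pivotRow n r a i := by
        rw [pivotRow, ← ha.wPerm_apply le_rfl (by omega) (by omega),
          ← idx_succ_val (Fin.castLE h i)]
        rfl
      rw [frame, Matrix.submatrix_apply, Units.val_mul, wElt_eq, mul_permGL_apply, h1, id]
    have hmono : ∀ i j : Fin r, i < j → (pivotRow n r a i : ℕ) < pivotRow n r a j := by
      intro i j hij
      rw [pivotRow, pivotRow, idx_val (ha.apply_lt _ (by omega) (by omega)),
        idx_val (ha.apply_lt _ (by omega) (by omega))]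
      have := ha.apply_lt_apply (i := i + 1) (j := j + 1) (by omega) (by omega) (by omega)
      omega
    have hbu : (b : Matrix (Fin n) (Fin n) k).BlockTriangular id := fun p q hpq => hb hpq
    have hA : ((frame h (b * wElt k n r a)).submatrix (pivotRow n r a) id).BlockTriangular id := by
      intro i j hij
      rw [Matrix.submatrix_apply, hf]
      exact hb (hmono _ _ hij)
    have hdb : ∀ p, (b : Matrix (Fin n) (Fin n) k) p p ≠ 0 := by
      have hdet : (b : Matrix (Fin n) (Fin n) k).det ≠ 0 :=
        ((Matrix.isUnit_iff_isUnit_det _).1 b.isUnit).ne_zero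
      rw [Matrix.det_of_isUpperTriangular hbu] at hdet
      exact fun p => Finset.prod_ne_zero_iff.1 hdet p (Finset.mem_univ p)
    have hd : ((frame h (b * wElt k n r a)).submatrix (pivotRow n r a) id).det ≠ 0 := by
      rw [Matrix.det_of_isUpperTriangular hA]
      refine Finset.prod_ne_zero_iff.2 fun i _ => ?_
      rw [Matrix.submatrix_apply, hf]
      exact hdb _
    refine ⟨_, (ha.mk_eq_chart h hd fun i j hij hjn => ?_).symm⟩
    rw [plucker, Matrix.mul_apply]
    refine Finset.sum_eq_zero fun l _ => ?_
    -- For `l ≤ i` the row `col r a j` lies below the pivot of column `l`, where `b` vanishes; for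
    -- `l > i` the adjugate vanishes.
    rcases le_or_gt l i with hli | hli
    · have h1 : frame h (b * wElt k n r a) (idx n (col r a j)) l = 0 := by
        rw [hf]
        refine hb ?_
        have h2 := ha.col_lt_iff (i := i + 1) (j := j) (by omega) (by omega) (by omega)
        have h3 := (ha.col_nonPivot j).2 (i + 1) (by omega) (by omega)
        have h4 := ha.apply_add_le (l + 1) (i + 1) (by omega) (by simpa using hli) (by omega)
        have h5 : (l : ℕ) ≤ i := hli
        show (pivotRow n r a l : ℕ) < idx n (col r a j)
        rw [pivotRow, idx_val hjn, idx_val (ha.apply_lt _ (by omega) (by omega))]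
        omega
      rw [h1, zero_mul]
    · have h1 : ((frame h (b * wElt k n r a)).submatrix (pivotRow n r a) id).adjugate.BlockTriangular
          id := by
        have : Invertible ((frame h (b * wElt k n r a)).submatrix (pivotRow n r a) id) :=
          Matrix.invertibleOfIsUnitDet _ (isUnit_iff_ne_zero.2 hd)
        have h2 := Matrix.blockTriangular_inv_of_blockTriangular hA
        intro p q hpq
        have h3 := h2 hpq
        rw [Matrix.inv_def, Matrix.smul_apply, smul_eq_mul] at h3
        exact (mul_eq_zero.1 h3).resolve_left
          (by rw [Ring.inverse_eq_inv']; exact inv_ne_zero hd)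
      rw [h1 hli, mul_zero]
  · rintro ⟨x, rfl⟩
    refine ⟨unipotent n r a x, ?_, rfl⟩
    intro p q hpq
    rw [ha.coe_unipotent, Matrix.add_apply, Matrix.one_apply_ne (by rintro rfl; simp at hpq),
      zero_add, rootSum, Matrix.sum_apply]
    refine Finset.sum_eq_zero fun i hi => ?_
    rw [Matrix.sum_apply]
    refine Finset.sum_eq_zero fun j hj => ?_
    rw [Finset.mem_Icc] at hi hj
    rw [Matrix.single_apply, if_neg]
    rintro ⟨rfl, rfl⟩
    have h1 := (ha.col_lt_iff hi.1 hi.2 hj.1).2 hj.2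
    have h2 := ha.col_le hi.1 hi.2 hj.1 hj.2
    have h3 : (idx n (a i + 1) : ℕ) < idx n (col r a j) := hpq
    rw [idx_val h2.2, idx_val (ha.apply_lt i hi.1 hi.2)] at h3
    omega

theorem Admissible.schubert_eq_closure [NeZero n] (ha : Admissible n r a) (h : r ≤ n) :
    schubert k n r a = closure[zariski k n r] (Set.range (chart n r a)) := by
  rw [schubert, ha.cell_eq_range h]

theorem Admissible.chart_mem_schubert [NeZero n] (ha : Admissible n r a) (h : r ≤ n)
    (x : ℕ → ℕ → k) : chart n r a x ∈ schubert k n r a := by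
  rw [ha.schubert_eq_closure h]
  exact @subset_closure _ (zariski k n r) _ _ ⟨x, rfl⟩

/-- These are equations valid on the cell, hence on its closure: the open set where one fails would
otherwise meet the cell. -/
theorem Admissible.plucker_eq_zero [NeZero n] (ha : Admissible n r a) (h : r ≤ n)
    {g : GL (Fin n) k} (hg : (g : Grass k n r) ∈ schubert k n r a) (i : Fin r) {j : ℕ}
    (hij : a (i + 1) - (i + 1) + 1 < j) (hjn : col r a j ≤ n) :
    plucker h (pivotRow n r a) g (idx n (col r a j)) i = 0 := by
  by_contra hne
  let _ := zariski k n r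
  rw [ha.schubert_eq_closure h] at hg
  obtain ⟨_, hv, x, rfl⟩ := mem_closure_iff.1 hg _ (isOpen_pluckerOpen h (pivotRow n r a) _ i)
    ((mk_mem_pluckerOpen_iff h _ _ _ g).2 hne)
  rw [chart_eq_mk, mk_mem_pluckerOpen_iff, ha.plucker_chart,
    ha.frame_chart_col h x (by omega) hjn, if_neg (by omega)] at hv
  exact hv rfl

/-- The open set that cuts out `openV` in the Schubert variety. -/
def coordOpen [NeZero n] (h : r ≤ n) (a : ℕ → ℕ) : Set (Grass k n r) :=
  ⋂ i : Fin r, pluckerOpen h (pivotRow n r a) (pivotRow n r a i) i ∩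
    ⋂ j ∈ Finset.Icc 1 (a (i + 1) - (i + 1) + 1),
      pluckerOpen h (pivotRow n r a) (idx n (col r a j)) i

theorem isOpen_coordOpen [NeZero n] (h : r ≤ n) (a : ℕ → ℕ) :
    IsOpen[zariski k n r] (coordOpen (k := k) h a) := by
  let _ := zariski k n r
  exact isOpen_iInter_of_finite fun i => (isOpen_pluckerOpen _ _ _ _).inter
    (isOpen_biInter_finset fun j _ => isOpen_pluckerOpen _ _ _ _)

/-- A point of `X(w)` with nonzero pivot minor satisfies the equations of `plucker_eq_zero`, so it
lies in the cell, with coordinates given by quotients of Plücker coordinates. -/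
theorem Admissible.openV_eq [NeZero n] (ha : Admissible n r a) (hr : 1 ≤ r) (h : r ≤ n) :
    openV k n r a = coordOpen h a ∩ schubert k n r a := by
  ext v
  constructor
  · rintro ⟨x, hx, rfl⟩
    refine ⟨Set.mem_iInter.2 fun i => ⟨?_, Set.mem_iInter₂.2 fun j hj => ?_⟩,
      ha.chart_mem_schubert h x⟩
    · rw [chart_eq_mk, mk_mem_pluckerOpen_iff, ha.plucker_chart, ha.frame_chart_pivot]
      simp
    · rw [Finset.mem_Icc] at hj
      rw [chart_eq_mk, mk_mem_pluckerOpen_iff, ha.plucker_chart,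
        ha.frame_chart_col h x hj.1 (ha.col_le (by omega) (by omega) hj.1 hj.2).2, if_pos hj.2]
      exact hx _ _ (by omega) (by omega) hj.1 hj.2
  · induction v using QuotientGroup.induction_on with | H g => ?_
    rintro ⟨hg, hgX⟩
    rw [coordOpen, Set.mem_iInter] at hg
    have hd : ((frame h g).submatrix (pivotRow n r a) id).det ≠ 0 := by
      have := (mk_mem_pluckerOpen_iff _ _ _ _ _).1 (hg ⟨0, hr⟩).1
      rwa [plucker_apply_pivot, if_pos rfl] at this
    refine ⟨_, fun i j hi hir hj hji => ?_,
      ha.mk_eq_chart h hd fun i j hij hjn => ha.plucker_eq_zero h hgX i hij hjn⟩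
    rw [cellCoord, dif_pos (by omega)]
    refine div_ne_zero ?_ hd
    refine (mk_mem_pluckerOpen_iff _ _ _ _ _).1
      (Set.mem_iInter₂.1 (hg ⟨i - 1, by omega⟩).2 j (Finset.mem_Icc.2 ⟨hj, ?_⟩))
    show j ≤ a (i - 1 + 1) - (i - 1 + 1) + 1
    rwa [Nat.sub_add_cancel hi]

/-! ### Density -/

theorem rootSum_add [NeZero n] (x y : ℕ → ℕ → k) :
    rootSum n r a (fun i j => x i j + y i j) = rootSum n r a x + rootSum n r a y := by
  simp only [rootSum, Matrix.single_add, Finset.sum_add_distrib]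

theorem rootSum_mul [NeZero n] (t : k) (x : ℕ → ℕ → k) :
    rootSum n r a (fun i j => t * x i j) = t • rootSum n r a x := by
  simp only [rootSum, Finset.smul_sum, Matrix.smul_single, smul_eq_mul]

/-- Shift all coordinates by a common `t`. A polynomial defining a basic neighbourhood becomes a
polynomial in `t` that is nonzero at `0`, and `∏ (t + x i j)` is a nonzero polynomial, so over an
infinite field some `t` avoids the zeros of both. -/
theorem Admissible.chart_mem_closure_openV [NeZero n] [Infinite k] (ha : Admissible n r a)
    (x : ℕ → ℕ → k) : chart n r a x ∈ closure[zariski k n r] (openV k n r a) := by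
  let _ := zariski k n r
  refine mem_closure_iff.2 fun O hO hx => ?_
  obtain ⟨f, hf, hfO⟩ := exists_basic_open (isOpen_coinduced.1 hO) hx
  set A : Matrix (Fin n) (Fin n) k :=
    ((unipotent n r a x * wElt k n r a : GL (Fin n) k) : Matrix (Fin n) (Fin n) k) with hA
  set B : Matrix (Fin n) (Fin n) k :=
    rootSum n r a (fun _ _ => 1) * (wElt k n r a : Matrix (Fin n) (Fin n) k) with hB
  -- The shift is written `t * 1` so that `rootSum_add` and `rootSum_mul` apply and the matrix is
  -- affine in `t`.
  have hAB : ∀ t : k, ((unipotent n r a (fun i j => x i j + t * 1) * wElt k n r a : GL (Fin n) k) :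
      Matrix (Fin n) (Fin n) k) = A + t • B := by
    intro t
    rw [hA, hB, Units.val_mul, Units.val_mul, ha.coe_unipotent, ha.coe_unipotent, rootSum_add,
      rootSum_mul, ← add_assoc, add_mul _ (t • _), Matrix.smul_mul]
  let F : Polynomial k := MvPolynomial.aeval (fun e : Fin n × Fin n =>
    Polynomial.C (A e.1 e.2) + Polynomial.X * Polynomial.C (B e.1 e.2)) f
  have hF : ∀ t : k, F.eval t =
      MvPolynomial.eval (fun e : Fin n × Fin n => (A + t • B) e.1 e.2) f := by
    intro t
    have h1 : (Polynomial.evalRingHom t).comp Polynomial.C = RingHom.id k := by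
      ext; simp
    simp only [F]
    rw [← Polynomial.coe_evalRingHom, MvPolynomial.aeval_def, MvPolynomial.hom_eval₂,
      Polynomial.algebraMap_eq, h1]
    refine congrArg (fun v => MvPolynomial.eval v f) (funext fun e => ?_)
    simp only [Polynomial.coe_evalRingHom, Polynomial.eval_add,
      Polynomial.eval_mul, Polynomial.eval_C, Polynomial.eval_X, Matrix.add_apply,
      Matrix.smul_apply, smul_eq_mul]
  let E : Polynomial k := ∏ i ∈ Finset.Icc 1 r, ∏ j ∈ Finset.Icc 1 (a i - i + 1),
    (Polynomial.X + Polynomial.C (x i j))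
  have hE : E ≠ 0 := Finset.prod_ne_zero_iff.2 fun i _ => Finset.prod_ne_zero_iff.2 fun j _ =>
    Polynomial.X_add_C_ne_zero _
  have hF0 : F ≠ 0 := by
    intro h0
    have := hF 0
    rw [h0, zero_smul, add_zero, Polynomial.eval_zero] at this
    exact hf this.symm
  obtain ⟨t, ht⟩ : ∃ t, (F * E).eval t ≠ 0 := by
    by_contra! hcon
    exact mul_ne_zero hF0 hE (Polynomial.funext fun t => by rw [hcon, Polynomial.eval_zero])
  rw [Polynomial.eval_mul] at ht
  refine ⟨chart n r a fun i j => x i j + t * 1, hfO _ ?_, _, fun i j hi hir hj hji => ?_, rfl⟩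
  · have := left_ne_zero_of_mul ht
    rw [hF, ← hAB] at this
    exact this
  · have := right_ne_zero_of_mul ht
    rw [Polynomial.eval_prod] at this
    have := Finset.prod_ne_zero_iff.1 this i (Finset.mem_Icc.2 ⟨hi, hir⟩)
    rw [Polynomial.eval_prod] at this
    have := Finset.prod_ne_zero_iff.1 this j (Finset.mem_Icc.2 ⟨hj, hji⟩)
    simpa [add_comm] using this

theorem Admissible.schubert_eq_closure_openV [NeZero n] [Infinite k] (ha : Admissible n r a)
    (h : r ≤ n) : schubert k n r a = closure[zariski k n r] (openV k n r a) := by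
  let _ := zariski k n r
  rw [ha.schubert_eq_closure h]
  refine (closure_minimal ?_ isClosed_closure).antisymm (closure_mono ?_)
  · rintro _ ⟨x, rfl⟩
    exact ha.chart_mem_closure_openV x
  · rintro _ ⟨x, -, rfl⟩
    exact ⟨x, rfl⟩

theorem Admissible.smul_mem_schubert [NeZero n] [Infinite k] (ha : Admissible n r a) (h : r ≤ n)
    {g : GL (Fin n) k} (hg : ∀ v ∈ openV k n r a, g • v ∈ schubert k n r a) {v : Grass k n r}
    (hv : v ∈ schubert k n r a) : g • v ∈ schubert k n r a := by
  let _ := zariski k n r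
  have hcl : closure (schubert k n r a) = schubert k n r a := by
    rw [schubert, closure_closure]
  rw [ha.schubert_eq_closure_openV h] at hv
  rw [← hcl]
  exact map_mem_closure (continuous_smul_zariski g) hv hg

/-- If `g` stabilises the Schubert variety, then the points `v` with `v` and `g⁻¹ v` in `openV` form
a dense open subset. -/
theorem Admissible.isDenseOpenIn [NeZero n] [Infinite k] (ha : Admissible n r a) (hr : 1 ≤ r)
    {g : GL (Fin n) k} (hg : ∀ v : Grass k n r, g • v ∈ schubert k n r a ↔ v ∈ schubert k n r a) :
    IsDenseOpenIn (schubert k n r a)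
      {v | v ∈ openV k n r a ∧ g⁻¹ • v ∈ openV k n r a} := by
  let _ := zariski k n r
  have h := ha.rank_le hr
  have hO := isOpen_coordOpen (k := k) h a
  have hV := ha.openV_eq (k := k) hr h
  have hg' : ∀ v : Grass k n r, g⁻¹ • v ∈ schubert k n r a ↔ v ∈ schubert k n r a := fun v => by
    rw [← hg, smul_inv_smul]
  have hcl := ha.schubert_eq_closure_openV (k := k) h
  refine ⟨⟨_, hO.inter (hO.preimage (continuous_smul_zariski g⁻¹)), ?_⟩, fun v hv => ?_⟩
  · ext v
    simp only [hV, Set.mem_inter_iff, Set.mem_preimage, Set.mem_ofPred_eq, hg']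
    tauto
  · refine mem_closure_iff.2 fun S hS hvS => ?_
    rw [hcl] at hv
    obtain ⟨v₁, hv₁S, hv₁⟩ := mem_closure_iff.1 hv S hS hvS
    rw [hV] at hv₁
    have h2 := (hg' v₁).2 hv₁.2
    rw [hcl] at h2
    -- Density is used a second time, near `g⁻¹ • v₁`: a point `v₂` of `V` there is chosen so that
    -- `g • v₂` stays both in `S` and in the open set defining `V`.
    obtain ⟨v₂, hv₂, hv₂V⟩ := mem_closure_iff.1 h2 _
      ((hS.inter hO).preimage (continuous_smul_zariski g))
      (show g • g⁻¹ • v₁ ∈ S ∩ coordOpen h a by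
        rw [smul_inv_smul]; exact ⟨hv₁S, hv₁.1⟩)
    refine ⟨g • v₂, hv₂.1, ?_, ?_⟩
    · rw [hV]
      rw [hV] at hv₂V
      exact ⟨hv₂.2, (hg v₂).2 hv₂V.2⟩
    · rwa [inv_smul_smul]

end TorusQuotient

namespace TorusQuotient

variable {k : Type*} [Field k] {n r : ℕ} {a : ℕ → ℕ}

/-! ### Representatives of a Weyl group element are monomial matrices -/

/-- Entries `u` and `u⁻¹` at `p` and `q` separate them as soon as `u ^ 2 ≠ 1`. -/
theorem exists_torus_separating [Infinite k] {p q : Fin n} (hpq : p ≠ q) :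
    ∃ t ∈ torus k n, (t : Matrix (Fin n) (Fin n) k) p p ≠ (t : Matrix (Fin n) (Fin n) k) q q := by
  classical
  obtain ⟨u, hu⟩ := Infinite.exists_notMem_finset ({0, 1, -1} : Finset k)
  simp only [Finset.mem_insert, Finset.mem_singleton, not_or] at hu
  obtain ⟨h0, h1, h2⟩ := hu
  let d : Fin n → k := Function.update (Function.update 1 p u) q u⁻¹
  have hd : (Matrix.diagonal d).det = 1 := by
    rw [Matrix.det_diagonal, Finset.prod_update_of_mem (Finset.mem_univ q),
      Finset.prod_update_of_mem (by simp [hpq])]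
    simp [h0]
  refine ⟨⟨Matrix.diagonal d, hd⟩, ⟨d, rfl⟩, fun h => ?_⟩
  simp only [Matrix.diagonal_apply_eq, d, Function.update_self, Function.update_of_ne hpq] at h
  have h3 : u ^ 2 = 1 := by
    rw [sq]
    nth_rewrite 2 [h]
    exact mul_inv_cancel₀ h0
  rcases sq_eq_one_iff.1 h3 with h4 | h4
  · exact h1 h4
  · exact h2 h4

/-- Comparing the entries at `(p, q)` in `g t = (g t g⁻¹) g` shows that a nonzero entry forces `t`
to agree at `σ⁻¹ p` and `q`, for every `t` in the torus. -/
theorem Represents.apply_eq_zero [Infinite k] {g : Matrix.SpecialLinearGroup (Fin n) k}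
    {σ : Equiv.Perm (Fin n)} (hg : Represents g σ) {p q : Fin n} (hpq : p ≠ σ q) :
    (g : Matrix (Fin n) (Fin n) k) p q = 0 := by
  by_contra hne
  have hσ : σ⁻¹ p ≠ q := fun h => hpq (Equiv.Perm.inv_eq_iff_eq.1 h)
  obtain ⟨t, ht, hpt⟩ := exists_torus_separating (k := k) hσ
  obtain ⟨d, hd⟩ := id ht
  obtain ⟨e, he⟩ := (Subgroup.mem_normalizer_iff.1 hg.1 t).1 ht
  have h1 := hg.2 t ht (σ⁻¹ p)
  rw [show σ (σ⁻¹ p) = p from σ.apply_symm_apply p] at h1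
  rw [he, Matrix.diagonal_apply_eq] at h1
  have h2 : (g : Matrix (Fin n) (Fin n) k) * (t : Matrix (Fin n) (Fin n) k) =
      Matrix.diagonal e * (g : Matrix (Fin n) (Fin n) k) := by
    rw [← he, ← Matrix.SpecialLinearGroup.coe_mul, ← Matrix.SpecialLinearGroup.coe_mul,
      inv_mul_cancel_right]
  have h3 := congrFun (congrFun h2 p) q
  rw [hd, Matrix.mul_diagonal, Matrix.diagonal_mul, mul_comm] at h3
  refine hpt ?_
  rw [← h1, hd, Matrix.diagonal_apply_eq, mul_right_cancel₀ hne h3]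

theorem inv_apply_eq_zero {g : GL (Fin n) k} {σ : Equiv.Perm (Fin n)}
    (hg : ∀ p q, p ≠ σ q → (g : Matrix (Fin n) (Fin n) k) p q = 0) {p q : Fin n}
    (hpq : p ≠ σ⁻¹ q) : ((g⁻¹ : GL (Fin n) k) : Matrix (Fin n) (Fin n) k) p q = 0 := by
  have h : ∀ p s, ((g⁻¹ : GL (Fin n) k) : Matrix (Fin n) (Fin n) k) p (σ s) *
      (g : Matrix (Fin n) (Fin n) k) (σ s) s = (1 : Matrix (Fin n) (Fin n) k) p s := by
    intro p s
    rw [← Units.val_one, ← inv_mul_cancel g, Units.val_mul, Matrix.mul_apply,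
      Finset.sum_eq_single (σ s) (fun l _ hl => by rw [hg l s hl, mul_zero]) (by simp)]
  have h1 := h (σ⁻¹ q) (σ⁻¹ q)
  have h2 := h p (σ⁻¹ q)
  rw [Matrix.one_apply_eq] at h1
  rw [Matrix.one_apply_ne hpq] at h2
  rw [show σ (σ⁻¹ q) = q from σ.apply_symm_apply q] at h1 h2
  exact (mul_eq_zero.1 h2).resolve_right (right_ne_zero_of_mul_eq_one h1)

theorem exists_eq_permGL_mul {g : GL (Fin n) k} {σ : Equiv.Perm (Fin n)}
    (hg : ∀ p q, p ≠ σ q → (g : Matrix (Fin n) (Fin n) k) p q = 0) :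
    ∃ (D : GL (Fin n) k) (d : Fin n → k), (∀ p, d p ≠ 0) ∧
      (D : Matrix (Fin n) (Fin n) k) = Matrix.diagonal d ∧ g = permGL k σ * D := by
  have hD : (((permGL k σ)⁻¹ * g : GL (Fin n) k) : Matrix (Fin n) (Fin n) k) =
      Matrix.diagonal fun q => (g : Matrix (Fin n) (Fin n) k) (σ q) q := by
    have h1 : ((permGL k σ)⁻¹ : GL (Fin n) k) = permGL k σ⁻¹ := by
      ext p q
      rfl
    ext p q
    rw [h1, Units.val_mul, permGL_mul_apply, inv_inv, Matrix.diagonal_apply]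
    split_ifs with hpq
    · rw [hpq]
    · exact hg _ _ fun h => hpq (σ.injective h)
  refine ⟨(permGL k σ)⁻¹ * g, _, fun p => ?_, hD, (mul_inv_cancel_left _ _).symm⟩
  have hdet : (((permGL k σ)⁻¹ * g : GL (Fin n) k) : Matrix (Fin n) (Fin n) k).det ≠ 0 :=
    ((Matrix.isUnit_iff_isUnit_det _).1 (Units.isUnit _)).ne_zero
  rw [hD, Matrix.det_diagonal] at hdet
  exact Finset.prod_ne_zero_iff.1 hdet p (Finset.mem_univ p)

/-! ### The action on the cell -/

theorem smul_chart [NeZero n] (g : GL (Fin n) k) (x : ℕ → ℕ → k) : g • chart n r a x =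
    ((g * (unipotent n r a x * wElt k n r a) : GL (Fin n) k) : Grass k n r) := rfl

/-- After scaling the rows, dividing each column by the factor at its pivot row restores the pivots
`1`. -/
theorem Admissible.diagonal_smul_chart [NeZero n] (ha : Admissible n r a) (h : r ≤ n)
    {D : GL (Fin n) k} {d : Fin n → k} (hd : ∀ p, d p ≠ 0)
    (hD : (D : Matrix (Fin n) (Fin n) k) = Matrix.diagonal d) (x : ℕ → ℕ → k) :
    D • chart n r a x = chart n r a fun i j =>
      d (idx n (col r a j)) / d (idx n (a i + 1)) * x i j := by
  rw [smul_chart, chart_eq_mk]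
  refine mk_eq_mk_of_frame h (Matrix.diagonal fun i => d (pivotRow n r a i)) ?_
  ext p i
  rw [frame_mul, hD, Matrix.diagonal_mul, Matrix.mul_diagonal, ha.frame_chart, ha.frame_chart]
  rcases pivot_or_col (r := r) (a := a) (Nat.succ_pos (p : ℕ)) with ⟨l, hl, hlr, hp⟩ | ⟨j, hj, hp⟩
  · have hp' : (p : ℕ) + 1 = a l + 1 := hp
    rw [hp', ha.echelon_pivot _ hl hlr (by omega) (by omega),
      ha.echelon_pivot _ hl hlr (by omega) (by omega)]
    split_ifs with hli
    · rw [mul_one, one_mul, pivotRow, ← hli, ← hp', idx_succ_val]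
    · simp
  · have hp' : (p : ℕ) + 1 = col r a j := hp
    rw [hp', ha.echelon_col _ hj (by omega) (by omega),
      ha.echelon_col _ hj (by omega) (by omega), ← hp', idx_succ_val]
    split_ifs
    · rw [pivotRow]
      have := hd (idx n (a (i + 1) + 1))
      field_simp
    · simp

theorem simpleRefl_apply_val [NeZero n] {j : ℕ} (hj : 1 ≤ j) (hjn : j + 1 ≤ n) (p : Fin n) :
    (simpleRefl n j p : ℕ) + 1 = Equiv.swap j (j + 1) ((p : ℕ) + 1) := by
  obtain ⟨m, hm, hmn, rfl⟩ : ∃ m, 1 ≤ m ∧ m ≤ n ∧ p = idx n m :=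
    ⟨p + 1, by omega, p.2, (idx_succ_val p).symm⟩
  rw [idx_val hmn, Nat.sub_add_cancel hm]
  by_cases h1 : m = j
  · rw [h1, simpleRefl_left, Equiv.swap_apply_left, idx_val hjn, Nat.add_sub_cancel]
  by_cases h2 : m = j + 1
  · rw [h2, simpleRefl_right, Equiv.swap_apply_right, idx_val (by omega), Nat.sub_add_cancel hj]
  · rw [simpleRefl_of_ne hj hjn hm hmn h1 h2, Equiv.swap_apply_of_ne_of_ne h1 h2, idx_val hmn,
      Nat.sub_add_cancel hm]

theorem sum_fin_succ {M : Type*} [AddCommMonoid M] (f : ℕ → M) :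
    ∑ l : Fin r, f (l + 1) = ∑ l ∈ Finset.Icc 1 r, f l := by
  rw [Fin.sum_univ_eq_sum_range (fun l => f (l + 1)), Finset.range_eq_Ico, Finset.sum_Ico_add']
  rfl

/-- If the permuted frame of `x` is the frame of `y` times `Q`, then the identity block in the pivot
rows forces `Q` to be the pivot rows of the permuted frame. With this `Q`, only the nonpivot rows,
indexed by `q`, remain to be checked. -/
theorem Admissible.simpleRefl_smul_chart [NeZero n] (ha : Admissible n r a) (h : r ≤ n) {j : ℕ}
    (hj : 1 ≤ j) (hjn : j + 1 ≤ n) {x y : ℕ → ℕ → k}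
    (hxy : ∀ q, 1 ≤ q → ∀ i, 1 ≤ i → i ≤ r →
      echelon r a x (Equiv.swap j (j + 1) (col r a q)) i =
        ∑ l ∈ Finset.Icc 1 r, (if q ≤ a l - l + 1 then y l q else 0) *
          echelon r a x (Equiv.swap j (j + 1) (a l + 1)) i) :
    permGL k (simpleRefl n j) • chart n r a x = chart n r a y := by
  rw [smul_chart, chart_eq_mk]
  refine mk_eq_mk_of_frame h (Matrix.of fun l i : Fin r =>
    echelon r a x (Equiv.swap j (j + 1) (a (l + 1) + 1)) (i + 1)) ?_
  ext p i
  rw [frame_mul, permGL_mul_apply, simpleRefl, Equiv.swap_inv, ← simpleRefl, ha.frame_chart,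
    simpleRefl_apply_val hj hjn, Matrix.mul_apply]
  simp only [ha.frame_chart, Matrix.of_apply]
  rw [sum_fin_succ fun l => echelon r a y (p + 1) l *
    echelon r a x (Equiv.swap j (j + 1) (a l + 1)) (i + 1)]
  rcases pivot_or_col (r := r) (a := a) (Nat.succ_pos (p : ℕ)) with ⟨l, hl, hlr, hp⟩ | ⟨q, hq, hp⟩
  · have hp' : (p : ℕ) + 1 = a l + 1 := hp
    rw [hp', Finset.sum_eq_single l, ha.echelon_pivot _ hl hlr hl hlr, if_pos rfl, one_mul]
    · intro l' hl' hne
      rw [Finset.mem_Icc] at hl'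
      rw [ha.echelon_pivot _ hl hlr hl'.1 hl'.2, if_neg hne.symm, zero_mul]
    · exact fun hl' => absurd (Finset.mem_Icc.2 ⟨hl, hlr⟩) hl'
  · have hp' : (p : ℕ) + 1 = col r a q := hp
    rw [hp', hxy q hq _ (by omega) (by omega)]
    refine Finset.sum_congr rfl fun l hl => ?_
    rw [Finset.mem_Icc] at hl
    rw [ha.echelon_col _ hq hl.1 hl.2]

/-- The value of `coordY` in terms of the coordinates. -/
noncomputable def ratio (r : ℕ) (a : ℕ → ℕ) (x : ℕ → ℕ → k) (i j : ℕ) : k :=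
  if 1 ≤ i ∧ i < r ∧ 1 ≤ j ∧ j ≤ a i - i then
    (x i (a i - i + 1) * x (i + 1) j) / (x i j * x (i + 1) (a i - i + 1))
  else 1

theorem Admissible.coordY_chart [NeZero n] (ha : Admissible n r a) (x : ℕ → ℕ → k) (i j : ℕ) :
    coordY n r a i j (chart n r a x) = ratio r a x i j := by
  rw [coordY, ratio]
  split_ifs with h
  · obtain ⟨hi, hir, hj, hji⟩ := h
    have := ha.length_mono hi (Nat.le_succ i) hir
    rw [ha.coordX_chart _ hi hir.le (by omega) le_rfl, ha.coordX_chart _ (by omega) hir hj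
      (by omega), ha.coordX_chart _ hi hir.le hj (by omega),
      ha.coordX_chart _ (by omega) hir (by omega) this]
  · rfl

/-- Numerator and denominator involve the same two first indices and the same two second indices, so
both acquire the same factor. -/
theorem ratio_scale {d e : ℕ → k} (hd : ∀ j, d j ≠ 0) (he : ∀ i, e i ≠ 0) (x : ℕ → ℕ → k)
    (i j : ℕ) : ratio r a (fun i j => d j / e i * x i j) i j = ratio r a x i j := by
  rw [ratio, ratio]
  split_ifs with h
  · rw [← mul_div_mul_left (x i (a i - i + 1) * x (i + 1) j) _
      (c := d j * d (a i - i + 1) / (e i * e (i + 1))) (by simp [hd, he])]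
    congr 1 <;> ring
  · rfl

/-- All coordinates are nonzero. -/
def CoordNeZero (r : ℕ) (a : ℕ → ℕ) (x : ℕ → ℕ → k) : Prop :=
  ∀ i j, 1 ≤ i → i ≤ r → 1 ≤ j → j ≤ a i - i + 1 → x i j ≠ 0

/-- To describe the action of `s_j` it suffices to know its action on the coordinates. -/
theorem Admissible.reflectionActs [NeZero n] [Infinite k] (ha : Admissible n r a) (hr : 1 ≤ r)
    {j : ℕ} {Φ : (Y sY : ℕ → ℕ → k) → Prop} (y : (ℕ → ℕ → k) → ℕ → ℕ → k)
    (hy : ∀ x, CoordNeZero r a x →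
      permGL k (simpleRefl n j) • chart n r a x = chart n r a (y x))
    (hΦ : ∀ x, CoordNeZero r a x → CoordNeZero r a (y x) →
      Φ (ratio r a x) (ratio r a (y x))) :
    ReflectionActs k n r a j Φ := by
  have h := ha.rank_le hr
  have hs : (simpleRefl n j)⁻¹ = simpleRefl n j := Equiv.swap_inv _ _
  -- The diagonal factor is absorbed into the coordinates, replacing `x` by an `x'` with the same
  -- ratios. This is applied below to `g` and to `g⁻¹`, both monomial for the same involution.
  have key : ∀ g : GL (Fin n) k,
      (∀ p q, p ≠ simpleRefl n j q → (g : Matrix (Fin n) (Fin n) k) p q = 0) →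
      ∀ x, CoordNeZero r a x → ∃ x', CoordNeZero r a x' ∧ ratio r a x' = ratio r a x ∧
        g • chart n r a x = chart n r a (y x') := by
    intro g hg x hx
    obtain ⟨D, d, hd, hD, rfl⟩ := exists_eq_permGL_mul hg
    have hx' : CoordNeZero r a fun i j => d (idx n (col r a j)) / d (idx n (a i + 1)) * x i j :=
      fun i j hi hir hj hji => mul_ne_zero (div_ne_zero (hd _) (hd _)) (hx i j hi hir hj hji)
    refine ⟨_, hx', ?_, ?_⟩
    · ext i j
      exact ratio_scale (d := fun j => d (idx n (col r a j))) (e := fun i => d (idx n (a i + 1)))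
        (fun _ => hd _) (fun _ => hd _) x i j
    · rw [mul_smul, ha.diagonal_smul_chart h hd hD, hy _ hx']
  intro g hg
  have hg₁ : ∀ p q, p ≠ simpleRefl n j q →
      ((g : GL (Fin n) k) : Matrix (Fin n) (Fin n) k) p q = 0 :=
    fun p q hpq => hg.apply_eq_zero hpq
  have hg₂ : ∀ p q, p ≠ simpleRefl n j q →
      (((g : GL (Fin n) k)⁻¹ : GL (Fin n) k) : Matrix (Fin n) (Fin n) k) p q = 0 :=
    fun p q hpq => inv_apply_eq_zero hg₁ (by rwa [hs])
  have hmem : ∀ g : GL (Fin n) k,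
      (∀ p q, p ≠ simpleRefl n j q → (g : Matrix (Fin n) (Fin n) k) p q = 0) →
      ∀ v ∈ schubert k n r a, g • v ∈ schubert k n r a := by
    intro g hg v hv
    refine ha.smul_mem_schubert h ?_ hv
    rintro _ ⟨x, hx, rfl⟩
    obtain ⟨x', -, -, hx'⟩ := key g hg x hx
    rw [hx']
    exact ha.chart_mem_schubert h _
  have hstab : ∀ v : Grass k n r,
      (g : GL (Fin n) k) • v ∈ schubert k n r a ↔ v ∈ schubert k n r a :=
    fun v => ⟨fun hv => by simpa using hmem _ hg₂ _ hv, hmem _ hg₁ v⟩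
  refine ⟨hstab, ha.isDenseOpenIn hr hstab, ?_⟩
  rintro v ⟨x, hx, rfl⟩ ⟨z, hz, hgz⟩
  obtain ⟨x', hx', hxx', hgx⟩ := key _ hg₂ x hx
  rw [hgx]
  simp only [ha.coordY_chart]
  -- The new coordinates are nonzero because `g⁻¹ • v` lies in `V` and coordinates in the cell are
  -- unique.
  have := hΦ x' hx' fun i j hi hir hj hji => by
    rw [ha.chart_inj (hgx.symm.trans hgz) hi hir hj hji]
    exact hz i j hi hir hj hji
  rwa [hxx'] at this

end TorusQuotient

namespace TorusQuotient

variable {k : Type*} [Field k] {n r : ℕ} {a : ℕ → ℕ}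

/-! ### The three kinds of simple reflections -/

theorem Admissible.col_eq (ha : Admissible n r a) {m p : ℕ} (hm : 1 ≤ m) (hp : p ≤ r)
    (h1 : 1 ≤ p → a p + 1 < m) (h2 : p < r → m < a (p + 1) + 1) : col r a (m - p) = m := by
  have h1' : ∀ i, 1 ≤ i → i ≤ p → a i + 1 < m := fun i hi hip => by
    have := ha.apply_add_le i p hi hip hp
    have := h1 (by omega)
    omega
  have h2' : ∀ i, p < i → i ≤ r → m < a i + 1 := fun i hi hir => by
    have := ha.apply_add_le (p + 1) i (by omega) hi hir
    have := h2 (by omega)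
    omega
  refine ha.col_sub ⟨hm, fun i hi hir => ?_⟩ hp h1' fun i hi hir => (h2' i hi hir).le
  rcases le_or_gt i p with hip | hip
  · exact (h1' i hi hip).ne'
  · exact (h2' i hip hir).ne

/-- A column with exactly `m` free entries would have its pivot between the nonpivot rows `col r a
m` and `col r a (m + 1)`, which are adjacent. -/
theorem Admissible.length_ne (ha : Admissible n r a) {m i : ℕ} (hm : 1 ≤ m)
    (hc : col r a (m + 1) = col r a m + 1) (hi : 1 ≤ i) (hir : i ≤ r) : a i - i + 1 ≠ m := by
  have h1 := ha.col_lt_iff hi hir hm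
  have h2 := ha.col_lt_iff hi hir (by omega : 1 ≤ m + 1)
  have h3 := (ha.col_nonPivot (m + 1)).2 i hi hir
  omega

/-- Interchange the coordinates with second index `m` and `m + 1`. -/
def swapCols (m : ℕ) (x : ℕ → ℕ → k) (i j : ℕ) : k := x i (Equiv.swap m (m + 1) j)

/-- Interchange the coordinates with first index `p` and `p + 1`. -/
def swapRows (p : ℕ) (x : ℕ → ℕ → k) (i j : ℕ) : k := x (Equiv.swap p (p + 1) i) j

/-- The effect on the coordinates of moving the pivot of column `p` to the nonpivot row with
index `m`. -/
def lowerPivot (p m : ℕ) (x : ℕ → ℕ → k) (i j : ℕ) : k :=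
  if i < p then x i j
  else if i = p then (if j = m then 1 / x p m else x p j / x p m)
  else if j < m then x i j - x i m * x p j / x p m
  else if j = m then -(x i m / x p m)
  else x i j

theorem swap_le_iff {m L q : ℕ} (hL : L ≠ m) : Equiv.swap m (m + 1) q ≤ L ↔ q ≤ L := by
  rw [Equiv.swap_apply_def]
  split_ifs <;> omega

theorem one_le_swap {m q : ℕ} (hm : 1 ≤ m) (hq : 1 ≤ q) : 1 ≤ Equiv.swap m (m + 1) q := by
  rw [Equiv.swap_apply_def]
  split_ifs <;> omega

theorem Admissible.simpleRefl_smul_swapCols [NeZero n] (ha : Admissible n r a) (h : r ≤ n)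
    {j m : ℕ} (hjn : j + 1 ≤ n) (hm : 1 ≤ m) (hc : col r a m = j) (hc' : col r a (m + 1) = j + 1)
    (x : ℕ → ℕ → k) :
    permGL k (simpleRefl n j) • chart n r a x = chart n r a (swapCols m x) := by
  have hj : 1 ≤ j := hc ▸ (ha.col_nonPivot m).1
  refine ha.simpleRefl_smul_chart h hj hjn fun q hq i hi hir => ?_
  have h1 : Equiv.swap j (j + 1) (col r a q) = col r a (Equiv.swap m (m + 1) q) := by
    rw [Equiv.swap_apply_def m, ← hc', ← hc, Equiv.swap_apply_def]
    simp only [ha.col_inj hq hm, ha.col_inj hq (Nat.succ_pos m)]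
    split_ifs <;> rfl
  have h2 : ∀ l ∈ Finset.Icc 1 r, (if q ≤ a l - l + 1 then swapCols m x l q else 0) *
      echelon r a x (Equiv.swap j (j + 1) (a l + 1)) i =
      if l = i then (if q ≤ a l - l + 1 then swapCols m x l q else 0) else 0 := by
    intro l hl
    rw [Finset.mem_Icc] at hl
    rw [Equiv.swap_apply_of_ne_of_ne, ha.echelon_pivot x hl.1 hl.2 hi hir, mul_ite, mul_one,
      mul_zero]
    · exact hc ▸ ((ha.col_nonPivot m).2 l hl.1 hl.2).symm
    · exact hc' ▸ ((ha.col_nonPivot (m + 1)).2 l hl.1 hl.2).symm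
  rw [h1, ha.echelon_col x (one_le_swap hm hq) hi hir, Finset.sum_congr rfl h2,
    Finset.sum_ite_eq', if_pos (Finset.mem_Icc.2 ⟨hi, hir⟩)]
  exact if_congr (swap_le_iff (ha.length_ne hm (by rw [hc, hc']) hi hir)) rfl rfl

/-- Exchanging two adjacent pivot rows is undone by exchanging the two columns, which have equally
many free entries. -/
theorem Admissible.simpleRefl_smul_swapRows [NeZero n] (ha : Admissible n r a) (h : r ≤ n)
    {p : ℕ} (hp : 1 ≤ p) (hpr : p + 1 ≤ r) (hap : a (p + 1) = a p + 1) (x : ℕ → ℕ → k) :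
    permGL k (simpleRefl n (a (p + 1))) • chart n r a x = chart n r a (swapRows p x) := by
  have hn := ha.apply_lt (p + 1) (by omega) hpr
  have hle := ha.le_apply p hp (by omega)
  refine ha.simpleRefl_smul_chart h (by omega) hn fun q hq i hi hir => ?_
  have hi' : 1 ≤ Equiv.swap p (p + 1) i ∧ Equiv.swap p (p + 1) i ≤ r :=
    ⟨one_le_swap hp hi, (swap_le_iff (by omega)).2 hir⟩
  have h1 : Equiv.swap (a (p + 1)) (a (p + 1) + 1) (col r a q) = col r a q :=
    Equiv.swap_apply_of_ne_of_ne (hap ▸ (ha.col_nonPivot q).2 p hp (by omega))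
      ((ha.col_nonPivot q).2 (p + 1) (by omega) hpr)
  have h2 : ∀ l ∈ Finset.Icc 1 r, (if q ≤ a l - l + 1 then swapRows p x l q else 0) *
      echelon r a x (Equiv.swap (a (p + 1)) (a (p + 1) + 1) (a l + 1)) i =
      if l = Equiv.swap p (p + 1) i then (if q ≤ a l - l + 1 then swapRows p x l q else 0)
      else 0 := by
    intro l hl
    rw [Finset.mem_Icc] at hl
    have h3 : Equiv.swap (a (p + 1)) (a (p + 1) + 1) (a l + 1) =
        a (Equiv.swap p (p + 1) l) + 1 := by
      by_cases hlp : l = p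
      · rw [hlp, ← hap, Equiv.swap_apply_left, Equiv.swap_apply_left]
      by_cases hlp' : l = p + 1
      · rw [hlp', Equiv.swap_apply_right, Equiv.swap_apply_right, hap]
      rw [Equiv.swap_apply_of_ne_of_ne hlp hlp', Equiv.swap_apply_of_ne_of_ne]
      · exact fun h => hlp (ha.apply_inj hl.1 hl.2 hp (by omega) (by omega))
      · exact fun h => hlp' (ha.apply_inj hl.1 hl.2 (by omega) hpr (by omega))
    rw [h3, ha.echelon_pivot x (one_le_swap hp hl.1) ((swap_le_iff (by omega)).2 hl.2) hi hir,
      mul_ite, mul_one, mul_zero]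
    refine if_congr ?_ rfl rfl
    rw [← Equiv.symm_apply_eq, Equiv.symm_swap, eq_comm]
  rw [h1, ha.echelon_col x hq hi hir, Finset.sum_congr rfl h2, Finset.sum_ite_eq',
    if_pos (Finset.mem_Icc.2 hi'), swapRows, Equiv.swap_apply_self]
  refine if_congr ?_ rfl rfl
  rw [Equiv.swap_apply_def]
  split_ifs with h4 h5
  · rw [h4]
    omega
  · rw [h5]
    omega
  · rfl

/-- After the exchange, row `a p + 1` holds the entries `x i m` for `i ≥ p` and row `a p` holds the
old pivot. Dividing column `p` by `x p m` and subtracting `x i m` times the result from each column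
`i > p` gives the echelon form `lowerPivot`. -/
theorem Admissible.simpleRefl_smul_lowerPivot [NeZero n] (ha : Admissible n r a) (h : r ≤ n)
    {p : ℕ} (hp : 1 ≤ p) (hpr : p ≤ r) (hap : 2 ≤ p → a (p - 1) + 2 ≤ a p) {x : ℕ → ℕ → k}
    (hx : x p (a p - p + 1) ≠ 0) :
    permGL k (simpleRefl n (a p)) • chart n r a x =
      chart n r a (lowerPivot p (a p - p + 1) x) := by
  have hn := ha.apply_lt p hp hpr
  have hle := ha.le_apply p hp hpr
  set m := a p - p + 1 with hm
  have hc : col r a m = a p := by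
    have := ha.col_eq (m := a p) (p := p - 1) (by omega) (by omega)
      (fun h => by have := hap (by omega); omega)
      (fun _ => by rw [Nat.sub_add_cancel hp]; omega)
    rwa [show a p - (p - 1) = m by omega] at this
  -- The gap of at least `2` before `a p` makes every column left of `p` too short to meet row `a
  -- p`.
  have hmi : ∀ i, 1 ≤ i → i ≤ r → (m ≤ a i - i + 1 ↔ p ≤ i) := by
    intro i hi hir
    constructor
    · intro hmi
      by_contra hip
      have := ha.apply_add_le i (p - 1) hi (by omega) (by omega)
      have := hap (by omega)
      have := ha.le_apply i hi hir
      omega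
    · exact fun hpi => ha.length_mono hp hpi hir
  refine ha.simpleRefl_smul_chart h (by omega) hn fun q hq i hi hir => ?_
  have h2 : ∀ l ∈ Finset.Icc 1 r, echelon r a x (Equiv.swap (a p) (a p + 1) (a l + 1)) i =
      (if l = p then (if p ≤ i then x i m else 0) else if l = i then 1 else 0) := by
    intro l hl
    rw [Finset.mem_Icc] at hl
    split_ifs with hlp hpi hli
    · rw [hlp, Equiv.swap_apply_right, ← hc, ha.echelon_col x (by omega) hi hir,
        if_pos ((hmi i hi hir).2 hpi)]
    · rw [hlp, Equiv.swap_apply_right, ← hc, ha.echelon_col x (by omega) hi hir,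
        if_neg fun h => hpi ((hmi i hi hir).1 h)]
    all_goals
      rw [Equiv.swap_apply_of_ne_of_ne, ha.echelon_pivot x hl.1 hl.2 hi hir]
      · simp [hli]
      · have := (ha.col_nonPivot m).2 l hl.1 hl.2
        omega
      · exact fun h => hlp (ha.apply_inj hl.1 hl.2 hp hpr (by omega))
  -- Only `l = p` and `l = i` contribute; for `i = p` the second summand is set to `0` so as not to
  -- count that term twice.
  have h3 : ∀ l ∈ Finset.Icc 1 r, (if q ≤ a l - l + 1 then lowerPivot p m x l q else 0) *
      echelon r a x (Equiv.swap (a p) (a p + 1) (a l + 1)) i =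
      (if l = p then (if q ≤ m then lowerPivot p m x p q else 0) *
        (if p ≤ i then x i m else 0) else 0) +
      (if l = i then (if i = p then 0 else if q ≤ a i - i + 1 then lowerPivot p m x i q else 0)
        else 0) := by
    intro l hl
    rw [h2 l hl]
    by_cases hlp : l = p
    · rw [if_pos hlp, if_pos hlp, hlp, ← hm]
      by_cases hpi : p = i
      · simp [hpi]
      · simp [hpi]
    · rw [if_neg hlp, if_neg hlp, zero_add]
      by_cases hli : l = i
      · rw [if_pos hli, if_pos hli, ← hli, if_neg hlp, mul_one]
      · rw [if_neg hli, if_neg hli, mul_zero]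
  rw [Finset.sum_congr rfl h3, Finset.sum_add_distrib, Finset.sum_ite_eq', Finset.sum_ite_eq',
    if_pos (Finset.mem_Icc.2 ⟨hp, hpr⟩), if_pos (Finset.mem_Icc.2 ⟨hi, hir⟩)]
  have hq2 : 1 ≤ m := by omega
  have hi' := hmi i hi hir
  by_cases hqm : q = m
  · subst hqm
    rw [hc, Equiv.swap_apply_left, ha.echelon_pivot x hp hpr hi hir]
    rcases lt_trichotomy i p with hip | hip | hip
    · have h5 : ¬ m ≤ a i - i + 1 := by omega
      simp [hip.ne, hip.ne', h5, not_le.2 hip]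
    · simp [hip, lowerPivot, hx]
    · have h5 : m ≤ a i - i + 1 := by omega
      simp [hip.ne, hip.ne', h5, hip.le, lowerPivot, not_lt.2 hip.le]
      field_simp
      ring
  · have h1 : Equiv.swap (a p) (a p + 1) (col r a q) = col r a q :=
      Equiv.swap_apply_of_ne_of_ne
        (fun h => hqm ((ha.col_inj hq hq2).1 (h.trans hc.symm)))
        ((ha.col_nonPivot q).2 p hp hpr)
    rw [h1, ha.echelon_col x hq hi hir]
    rcases lt_trichotomy i p with hip | hip | hip
    · simp [hip.ne, not_le.2 hip, lowerPivot, hip]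
    · subst hip
      simp only [lowerPivot, lt_irrefl, if_false, if_true, le_refl, hqm, ← hm, add_zero]
      split_ifs
      · field_simp
      · simp
    · have h5 : m ≤ a i - i + 1 := by omega
      rcases lt_or_gt_of_ne hqm with hq3 | hq3
      · have h6 : q ≤ a i - i + 1 := by omega
        simp [hip.ne', hip.le, lowerPivot, not_lt.2 hip.le, hqm, hq3, h6, hq3.le]
        field_simp
        ring
      · simp [hip.ne', hip.le, lowerPivot, not_lt.2 hip.le, hqm, hq3.not_gt, hq3.not_ge]

/-! ### The action on the invariant functions -/

theorem ratio_eq {x : ℕ → ℕ → k} {i j : ℕ} (hi : 1 ≤ i) (hir : i < r) (hj : 1 ≤ j)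
    (hji : j ≤ a i - i) : ratio r a x i j =
      (x i (a i - i + 1) * x (i + 1) j) / (x i j * x (i + 1) (a i - i + 1)) :=
  if_pos ⟨hi, hir, hj, hji⟩

theorem ratio_eq_one {x : ℕ → ℕ → k} {i j : ℕ} (h : r ≤ i ∨ a i - i < j) : ratio r a x i j = 1 :=
  if_neg (by omega)

/-- The hypotheses say that the normalising index `a i - i + 1` is neither `m` nor `m + 1`, so the
exchange does not move it. When it is `m + 1`, inverses appear, as in `ratio_swapCols_last`. -/
theorem ratio_swapCols {m i j : ℕ} (hm : 1 ≤ m) (hj : 1 ≤ j) (h1 : a i - i + 1 ≠ m)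
    (h2 : a i - i ≠ m) (x : ℕ → ℕ → k) :
    ratio r a (swapCols m x) i j = ratio r a x i (Equiv.swap m (m + 1) j) := by
  have h3 := one_le_swap hm hj
  have h4 : Equiv.swap m (m + 1) j ≤ a i - i ↔ j ≤ a i - i := swap_le_iff h2
  have h5 : Equiv.swap m (m + 1) (a i - i + 1) = a i - i + 1 :=
    Equiv.swap_apply_of_ne_of_ne h1 (by omega)
  simp only [ratio, swapCols, h3, h4, hj, h5]

theorem ratio_swapCols_of_lt {m i j : ℕ} (h : a i - i + 1 < m) (x : ℕ → ℕ → k) :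
    ratio r a (swapCols m x) i j = ratio r a x i j := by
  by_cases hj : 1 ≤ j ∧ j ≤ a i - i
  · rw [ratio_swapCols (by omega) hj.1 (by omega) (by omega),
      Equiv.swap_apply_of_ne_of_ne (by omega) (by omega)]
  · rw [ratio, ratio, if_neg (by tauto), if_neg (by tauto)]

theorem ratio_swapCols_interchange {m i : ℕ} (hm : 1 ≤ m) (h : m < a i - i) (x : ℕ → ℕ → k) :
    ratio r a (swapCols m x) i m = ratio r a x i (m + 1) ∧
      ratio r a (swapCols m x) i (m + 1) = ratio r a x i m ∧
      ∀ l, 1 ≤ l → l ≠ m → l ≠ m + 1 → ratio r a (swapCols m x) i l = ratio r a x i l := by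
  refine ⟨?_, ?_, fun l hl h1 h2 => ?_⟩
  · rw [ratio_swapCols hm hm (by omega) (by omega), Equiv.swap_apply_left]
  · rw [ratio_swapCols hm (by omega) (by omega) (by omega), Equiv.swap_apply_right]
  · rw [ratio_swapCols hm hl (by omega) (by omega), Equiv.swap_apply_of_ne_of_ne h1 h2]

theorem ratio_swapCols_last {m i : ℕ} (hi : 1 ≤ i) (hir : i < r) (hm : 1 ≤ m)
    (h : a i - i = m) (x : ℕ → ℕ → k) :
    ratio r a (swapCols m x) i m = (ratio r a x i m)⁻¹ := by
  rw [ratio_eq hi hir hm h.ge, ratio_eq hi hir hm h.ge, h]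
  simp only [swapCols, Equiv.swap_apply_left, Equiv.swap_apply_right]
  rw [inv_div]

theorem ratio_swapCols_of_lt_last {m i l : ℕ} (hi : 1 ≤ i) (hir : i < r) (hl : 1 ≤ l) (hlm : l < m)
    (h : a i - i = m) {x : ℕ → ℕ → k} (h1 : x i (m + 1) ≠ 0) (h2 : x (i + 1) (m + 1) ≠ 0) :
    ratio r a (swapCols m x) i l = ratio r a x i l * (ratio r a x i m)⁻¹ := by
  rw [ratio_eq hi hir hl (by omega), ratio_eq hi hir hl (by omega),
    ratio_eq hi hir (by omega) h.ge, h]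
  simp only [swapCols, Equiv.swap_apply_right]
  rw [Equiv.swap_apply_of_ne_of_ne (by omega) (by omega), inv_div, div_mul_div_comm,
    ← mul_div_mul_left (x i m * x (i + 1) l) _ (mul_ne_zero h1 h2)]
  congr 1 <;> ring

theorem Admissible.ratio_swapRows_pred (ha : Admissible n r a) {p l : ℕ} (hp : 2 ≤ p)
    (hpr : p < r) (hap : a (p + 1) = a p + 1) (hl : 1 ≤ l) (hla : l ≤ a (p - 1) - (p - 1))
    {x : ℕ → ℕ → k} (hx : CoordNeZero r a x) :
    ratio r a (swapRows p x) (p - 1) l =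
      ratio r a x (p - 1) l * ratio r a x p l * (ratio r a x p (a (p - 1) - (p - 1) + 1))⁻¹ := by
  obtain ⟨i, rfl⟩ : ∃ i, p = i + 1 := ⟨p - 1, by omega⟩
  rw [Nat.add_sub_cancel] at hla ⊢
  have h1 := ha.length_mono (i := i) (j := i + 1) (by omega) (by omega) (by omega)
  have h2 := ha.length_mono (i := i + 1) (j := i + 1 + 1) (by omega) (by omega) (by omega)
  have e1 := hx (i + 1) l (by omega) (by omega) hl (by omega)
  have e2 := hx (i + 1 + 1) l (by omega) (by omega) hl (by omega)
  have e3 := hx (i + 1) (a i - i + 1) (by omega) (by omega) (by omega) (by omega)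
  have e4 := hx (i + 1 + 1) (a i - i + 1) (by omega) (by omega) (by omega) (by omega)
  have e5 := hx i (a i - i + 1) (by omega) (by omega) (by omega) (by omega)
  have e6 := hx i l (by omega) (by omega) (by omega) (by omega)
  have e7 := hx (i + 1) (a (i + 1) - (i + 1) + 1) (by omega) (by omega) (by omega) le_rfl
  have e8 := hx (i + 1 + 1) (a (i + 1) - (i + 1) + 1) (by omega) (by omega) (by omega) h2
  rw [ratio_eq (by omega) (by omega) hl hla, ratio_eq (by omega) (by omega) hl hla,
    ratio_eq (by omega) (by omega) hl (by omega)]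
  simp only [swapRows, Equiv.swap_apply_left]
  rw [Equiv.swap_apply_of_ne_of_ne (by omega) (by omega)]
  -- In the case of equality the inverted factor lies just outside its range and is `1` by
  -- convention.
  by_cases h3 : a i - i + 1 = a (i + 1) - (i + 1) + 1
  · rw [ratio_eq_one (i := i + 1) (by omega), ← h3]
    field_simp
  · rw [ratio_eq (i := i + 1) (by omega) (by omega) (by omega) (by omega)]
    field_simp

theorem ratio_swapRows_self {p l : ℕ} (hp : 1 ≤ p) (hpr : p < r) (hl : 1 ≤ l) (hla : l ≤ a p - p)
    (x : ℕ → ℕ → k) : ratio r a (swapRows p x) p l = (ratio r a x p l)⁻¹ := by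
  rw [ratio_eq hp hpr hl hla, ratio_eq hp hpr hl hla]
  simp only [swapRows, Equiv.swap_apply_left, Equiv.swap_apply_right]
  rw [inv_div, mul_comm, mul_comm (x p l)]
  congr 1
  all_goals rw [mul_comm]

theorem Admissible.ratio_swapRows_succ (ha : Admissible n r a) {p l : ℕ} (hp : 1 ≤ p)
    (hpr : p + 1 < r) (hap : a (p + 1) = a p + 1) (hl : 1 ≤ l) (hla : l ≤ a p - p)
    {x : ℕ → ℕ → k} (hx : CoordNeZero r a x) :
    ratio r a (swapRows p x) (p + 1) l = ratio r a x (p + 1) l * ratio r a x p l := by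
  have hle := ha.le_apply p hp (by omega)
  have h1 : a (p + 1) - (p + 1) = a p - p := by omega
  have e1 := hx p l hp (by omega) hl (by omega)
  have e2 := hx (p + 1) l (by omega) (by omega) hl (by omega)
  have e3 := hx (p + 1) (a p - p + 1) (by omega) (by omega) (by omega) (by omega)
  rw [ratio_eq (by omega) hpr hl (by omega), ratio_eq (by omega) hpr hl (by omega),
    ratio_eq hp (by omega) hl hla, h1]
  simp only [swapRows, Equiv.swap_apply_right]
  rw [Equiv.swap_apply_of_ne_of_ne (by omega : p + 1 + 1 ≠ p) (by omega)]
  field_simp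

theorem ratio_swapRows_of_ne {p i l : ℕ} (h1 : i + 1 ≠ p) (h2 : i ≠ p) (h3 : i ≠ p + 1)
    (x : ℕ → ℕ → k) : ratio r a (swapRows p x) i l = ratio r a x i l := by
  simp only [ratio, swapRows]
  rw [Equiv.swap_apply_of_ne_of_ne h2 h3, Equiv.swap_apply_of_ne_of_ne h1 (by omega)]

/-- The quantity that governs the action of a reflection lowering the pivot of column `p`. -/
def crossRatio (p m : ℕ) (x : ℕ → ℕ → k) (i l : ℕ) : k :=
  (x i l * x p m) / (x i m * x p l)

/-- In each factor the coordinates at the normalising index `a t - t + 1` cancel, and what is left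
telescopes. If `a t - t = a p - p`, the denominator is the conventional `1`, which agrees with the
defining quotient. -/
theorem Admissible.prod_ratio_div (ha : Admissible n r a) {p i l : ℕ} (hp : 1 ≤ p) (hpi : p < i)
    (hir : i ≤ r) (hl : 1 ≤ l) (hla : l ≤ a p - p) {x : ℕ → ℕ → k} (hx : CoordNeZero r a x) :
    ∏ t ∈ Finset.Ico p i, ratio r a x t l / ratio r a x t (a p - p + 1) =
      crossRatio p (a p - p + 1) x i l := by
  have e1 : ∀ t, p ≤ t → t ≤ r → x t l ≠ 0 := fun t ht htr => by
    have := ha.length_mono hp ht htr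
    exact hx t l (by omega) htr hl (by omega)
  have e2 : ∀ t, p ≤ t → t ≤ r → x t (a p - p + 1) ≠ 0 := fun t ht htr =>
    hx t _ (by omega) htr (by omega) (ha.length_mono hp ht htr)
  have key : ∀ t, p ≤ t → t < r → ratio r a x t l / ratio r a x t (a p - p + 1) =
      (x (t + 1) l * x t (a p - p + 1)) / (x (t + 1) (a p - p + 1) * x t l) := by
    intro t ht htr
    have h1 := ha.length_mono hp ht htr.le
    have h2 := ha.length_mono (by omega) (Nat.le_succ t) htr
    have e3 := hx t (a t - t + 1) (by omega) (by omega) (by omega) le_rfl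
    have e4 := hx (t + 1) (a t - t + 1) (by omega) htr (by omega) h2
    have e5 := e1 t ht htr.le
    have e6 := e1 (t + 1) (by omega) htr
    have e7 := e2 t ht htr.le
    have e8 := e2 (t + 1) (by omega) htr
    rw [ratio_eq (by omega) htr hl (by omega)]
    by_cases h3 : a p - p + 1 ≤ a t - t
    · rw [ratio_eq (by omega) htr (by omega) h3]
      field_simp
    · rw [ratio_eq_one (by omega), show a t - t = a p - p by omega]
      field_simp
  induction i, hpi using Nat.le_induction with
  | base => rw [Nat.Ico_succ_singleton, Finset.prod_singleton, key p le_rfl (by omega), crossRatio]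
  | succ i hpi ih =>
    rw [Finset.prod_Ico_succ_top (by omega), ih (by omega), key i (by omega) (by omega),
      crossRatio, crossRatio]
    have := e1 i (by omega) (by omega)
    have := e1 (i + 1) (by omega) (by omega)
    have := e2 i (by omega) (by omega)
    have := e2 (i + 1) (by omega) (by omega)
    have := e1 p le_rfl (by omega)
    have := e2 p le_rfl (by omega)
    field_simp

/-- For `i = p - 1` the entries of column `p` involved are all divided by `x p m`, where `m = a p -
p + 1`. For `i > p` those at index `m` are multiplied by `-1 / x p m` and those beyond are
unchanged. These common factors cancel. -/
theorem Admissible.ratio_lowerPivot_of_fixed (ha : Admissible n r a) {p i l : ℕ} (hp : 1 ≤ p)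
    (hpr : p ≤ r) (hap : 2 ≤ p → a (p - 1) + 2 ≤ a p) (h : i < p ∨ a p - p + 1 ≤ l)
    {x : ℕ → ℕ → k} (hx : CoordNeZero r a x) :
    ratio r a (lowerPivot p (a p - p + 1) x) i l = ratio r a x i l := by
  have hle := ha.le_apply p hp hpr
  have hm := hx p (a p - p + 1) hp hpr (by omega) le_rfl
  rw [ratio, ratio]
  split_ifs with hc
  swap; · rfl
  obtain ⟨hi, hir, hl, hla⟩ := hc
  have hla' := ha.le_apply i hi hir.le
  rcases lt_or_ge i p with hip | hip
  · rcases (Nat.succ_le_iff.2 hip).lt_or_eq with hip' | rfl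
    · have : i + 1 < p := hip'
      simp only [lowerPivot, hip, this, if_true]
    · have h1 := hap (by omega)
      rw [Nat.succ_eq_add_one, Nat.add_sub_cancel] at h1
      have h2 : a i - i + 1 ≠ a (i + 1) - (i + 1) + 1 := by omega
      have h3 : l ≠ a (i + 1) - (i + 1) + 1 := by omega
      simp only [lowerPivot, Nat.succ_eq_add_one, hip, lt_irrefl, if_true, if_false, h2, h3]
      rw [Nat.succ_eq_add_one] at hm
      have e1 := hx i l hi hir.le hl (by omega)
      have e2 := hx (i + 1) (a i - i + 1) (by omega) hir (by omega) (by omega)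
      field_simp
  · have hip' : p < i := by
      rcases hip.lt_or_eq with h1 | rfl
      · exact h1
      · omega
    have h1 : ¬ i < p := by omega
    have h2 : ¬ i + 1 < p := by omega
    have h3 : i ≠ p := by omega
    have h4 : i + 1 ≠ p := by omega
    have h5 : ¬ a i - i + 1 < a p - p + 1 := by omega
    have h6 : a i - i + 1 ≠ a p - p + 1 := by omega
    have h7 : ¬ l < a p - p + 1 := by omega
    simp only [lowerPivot, h1, h2, h3, h4, h5, h6, h7, if_false]
    split_ifs with h8
    · rw [h8]
      have := ha.length_mono hp hip hir.le
      have := ha.length_mono hi (Nat.le_succ i) hir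
      have e1 := hx i (a p - p + 1) hi hir.le (by omega) (by omega)
      have e2 := hx (i + 1) (a i - i + 1) (by omega) hir (by omega) (by omega)
      field_simp
    · rfl

theorem lowerPivot_of_gt {p m i l : ℕ} (hpi : p < i) (hl : l < m) {x : ℕ → ℕ → k}
    (h1 : x p m ≠ 0) (h2 : x p l ≠ 0) (h3 : x i m ≠ 0) :
    lowerPivot p m x i l = -(x i m * x p l / x p m * (1 - crossRatio p m x i l)) := by
  rw [lowerPivot, if_neg (by omega), if_neg (by omega), if_pos hl, crossRatio]
  field_simp
  ring

theorem Admissible.ratio_lowerPivot_self (ha : Admissible n r a) {p l : ℕ} (hp : 1 ≤ p)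
    (hpr : p < r) (hl : 1 ≤ l) (hla : l ≤ a p - p) {x : ℕ → ℕ → k} (hx : CoordNeZero r a x) :
    ratio r a (lowerPivot p (a p - p + 1) x) p l = 1 - ratio r a x p l := by
  have h1 := ha.length_mono hp (Nat.le_succ p) hpr
  have e1 := hx p (a p - p + 1) hp hpr.le (by omega) le_rfl
  have e2 := hx (p + 1) (a p - p + 1) (by omega) hpr (by omega) h1
  have e3 := hx p l hp hpr.le hl (by omega)
  have h2 : l ≠ a p - p + 1 := by omega
  have h3 : l < a p - p + 1 := by omega
  rw [ratio_eq hp hpr hl hla, ratio_eq hp hpr hl hla]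
  simp only [lowerPivot, lt_irrefl, if_true, if_false, h2, h3, Nat.succ_ne_self,
    show ¬ p + 1 < p by omega]
  field_simp
  ring

/-- By `lowerPivot_of_gt` the denominator is the new coordinate at `(i, l)` up to a nonzero factor,
hence nonzero. The remaining factors combine to `ratio r a x i (a p - p + 1)`, which is `1` if that
index is already the normalising one. -/
theorem Admissible.ratio_lowerPivot_of_gt (ha : Admissible n r a) {p i l : ℕ} (hp : 1 ≤ p)
    (hpi : p < i) (hir : i < r) (hl : 1 ≤ l) (hla : l ≤ a p - p) {x : ℕ → ℕ → k}
    (hx : CoordNeZero r a x) (hx' : CoordNeZero r a (lowerPivot p (a p - p + 1) x)) :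
    1 - crossRatio p (a p - p + 1) x i l ≠ 0 ∧
      ratio r a (lowerPivot p (a p - p + 1) x) i l =
        (1 - crossRatio p (a p - p + 1) x (i + 1) l) / (1 - crossRatio p (a p - p + 1) x i l) *
          ratio r a x i (a p - p + 1) := by
  have h1 := ha.length_mono hp hpi.le hir.le
  have h2 := ha.length_mono (hp.trans hpi.le) (Nat.le_succ i) hir
  have h3 : l < a p - p + 1 := by omega
  have e1 := hx p (a p - p + 1) hp (by omega) (by omega) le_rfl
  have e2 := hx p l hp (by omega) hl (by omega)
  have e3 := hx i (a p - p + 1) (by omega) hir.le (by omega) h1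
  have e4 := hx (i + 1) (a p - p + 1) (by omega) hir (by omega) (h1.trans h2)
  have e5 := hx' i l (by omega) hir.le hl (by omega)
  have e6 := hx i (a i - i + 1) (by omega) hir.le (by omega) le_rfl
  have e7 := hx (i + 1) (a i - i + 1) (by omega) hir (by omega) h2
  have h4 : 1 - crossRatio p (a p - p + 1) x i l ≠ 0 := by
    intro h0
    rw [lowerPivot_of_gt hpi h3 e1 e2 e3, h0, mul_zero, neg_zero] at e5
    exact e5 rfl
  refine ⟨h4, ?_⟩
  rw [ratio_eq (by omega) hir hl (by omega), lowerPivot_of_gt hpi h3 e1 e2 e3,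
    lowerPivot_of_gt (by omega) h3 e1 e2 e4]
  generalize crossRatio p (a p - p + 1) x i l = T at h4
  generalize crossRatio p (a p - p + 1) x (i + 1) l = T'
  simp only [lowerPivot, show ¬ i < p by omega, show ¬ i + 1 < p by omega, show i ≠ p by omega,
    show i + 1 ≠ p by omega, if_false, show ¬ a i - i + 1 < a p - p + 1 by omega]
  split_ifs with h5
  · rw [ratio_eq_one (by omega)]
    field_simp
  · rw [ratio_eq (by omega) hir (by omega) (by omega)]
    field_simp

end TorusQuotient

/-! ### The listed reflections sorted into the three kinds. -/

theorem proposition3p2 (k : Type*) [Field k] [IsAlgClosed k] (n r : ℕ) [NeZero n]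
    (hr : 2 ≤ r) (hrn : r ≤ n - 2)
    (a : ℕ → ℕ) (ha_first : 1 ≤ a 1) (ha_last : a r ≤ n - 1)
    (ha_mono : ∀ i, 1 ≤ i → i < r → a i < a (i + 1)) :
    -- 1.
    (∀ j, 1 ≤ j → j ≤ a 1 - 2 →
      TorusQuotient.ReflectionActs k n r a j fun Y sY =>
        ∀ i, 1 ≤ i → i ≤ r - 1 →
          sY i j = Y i (j + 1) ∧ sY i (j + 1) = Y i j ∧
          ∀ l, 1 ≤ l → l ≤ a i - i → l ≠ j → l ≠ j + 1 → sY i l = Y i l) ∧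
    -- 2.
    (∀ p j, 1 ≤ p → p ≤ r - 1 → a p + 2 ≤ j → j ≤ a (p + 1) - 2 →
      TorusQuotient.ReflectionActs k n r a j fun Y sY =>
        (∀ i, p + 1 ≤ i → i ≤ r - 1 →
          sY i (j - p) = Y i (j - p + 1) ∧ sY i (j - p + 1) = Y i (j - p)) ∧
        ∀ i l, 1 ≤ i → i ≤ r - 1 → 1 ≤ l → l ≤ a i - i →
          ¬(p + 1 ≤ i ∧ (l = j - p ∨ l = j - p + 1)) → sY i l = Y i l) ∧
    -- 3.
    (∀ p, 1 ≤ p → p ≤ r → (p = 1 → 2 ≤ a 1) → (2 ≤ p → a (p - 1) + 3 ≤ a p) →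
      TorusQuotient.ReflectionActs k n r a (a p - 1) fun Y sY =>
        -- (a)
        (∀ i l, 1 ≤ i → i ≤ p - 1 → 1 ≤ l → l ≤ a i - i → sY i l = Y i l) ∧
        -- (b)
        (∀ i, p ≤ i → i ≤ r - 1 → a i - i = a p - p →
          sY i (a p - p) = (Y i (a p - p))⁻¹ ∧
          ∀ l, 1 ≤ l → l < a p - p → sY i l = Y i l * (Y i (a p - p))⁻¹) ∧
        -- (c)
        (∀ i, p + 1 ≤ i → i ≤ r - 1 → a p - p < a i - i →
          sY i (a p - p) = Y i (a p - p + 1) ∧ sY i (a p - p + 1) = Y i (a p - p) ∧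
          ∀ l, 1 ≤ l → l ≤ a i - i → l ≠ a p - p → l ≠ a p - p + 1 → sY i l = Y i l)) ∧
    -- 4. (a)
    (∀ p, 2 ≤ p → p ≤ r - 1 → a p = a (p - 1) + 1 →
      TorusQuotient.ReflectionActs k n r a (a p) fun Y sY =>
        -- (i)
        (3 ≤ p → ∀ l, 1 ≤ l → l ≤ a (p - 2) + 2 - p →
          sY (p - 2) l = Y (p - 2) l * Y (p - 1) l * (Y (p - 1) (a (p - 2) + 3 - p))⁻¹) ∧
        -- (ii)
        (∀ l, 1 ≤ l → l ≤ a p - p →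
          sY (p - 1) l = (Y (p - 1) l)⁻¹ ∧ sY p l = Y p l * Y (p - 1) l) ∧
        -- (iii)
        (∀ i l, 1 ≤ i → i ≤ r - 1 → i + 2 ≠ p → i + 1 ≠ p → i ≠ p → 1 ≤ l → l ≤ a i - i →
          sY i l = Y i l)) ∧
    -- 4. (b)
    (∀ p, 1 ≤ p → p ≤ r - 1 → (2 ≤ p → a (p - 1) + 2 ≤ a p) →
      TorusQuotient.ReflectionActs k n r a (a p) fun Y sY =>
        -- (i)
        (∀ i l, 1 ≤ i → i ≤ r - 1 → 1 ≤ l → l ≤ a r → (i ≤ p - 1 ∨ a p - p + 1 ≤ l) →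
          sY i l = Y i l) ∧
        -- (ii)
        (∀ l, 1 ≤ l → l ≤ a p - p → sY p l = 1 - Y p l) ∧
        -- (iii)
        (∀ i l, p + 1 ≤ i → i ≤ r - 1 → 1 ≤ l → l ≤ a p - p →
          1 - ∏ m ∈ Finset.Icc p (i - 1), Y m l / Y m (a p - p + 1) ≠ 0 ∧
          sY i l = (1 - ∏ m ∈ Finset.Icc p i, Y m l / Y m (a p - p + 1)) /
            (1 - ∏ m ∈ Finset.Icc p (i - 1), Y m l / Y m (a p - p + 1)) *
            Y i (a p - p + 1))) ∧
    -- 4. (c)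
    (a r = a (r - 1) + 1 →
      TorusQuotient.ReflectionActs k n r a (a r) fun Y sY =>
        (3 ≤ r → ∀ l, 1 ≤ l → l ≤ a (r - 2) + 2 - r →
          sY (r - 2) l = Y (r - 2) l * Y (r - 1) l * (Y (r - 1) (a (r - 2) + 3 - r))⁻¹) ∧
        (∀ l, 1 ≤ l → l ≤ a r - r → sY (r - 1) l = (Y (r - 1) l)⁻¹) ∧
        (∀ i l, 1 ≤ i → i ≤ r - 1 → i + 2 ≠ r → i + 1 ≠ r → 1 ≤ l → l ≤ a i - i →
          sY i l = Y i l)) ∧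
    (a (r - 1) + 2 ≤ a r →
      TorusQuotient.ReflectionActs k n r a (a r) fun Y sY =>
        ∀ i l, 1 ≤ i → i ≤ r → 1 ≤ l → l ≤ a r - r + 1 → sY i l = Y i l) := by
  have hn : n ≠ 0 := NeZero.ne n
  have ha : TorusQuotient.Admissible n r a :=
    TorusQuotient.Admissible.of_lt (by omega) ha_first ha_last ha_mono
  have hr1 : 1 ≤ r := by omega
  have h := ha.rank_le hr1
  have hswapCols : ∀ {j m : ℕ} {Φ : (Y sY : ℕ → ℕ → k) → Prop}, j + 1 ≤ n → 1 ≤ m →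
      TorusQuotient.col r a m = j → TorusQuotient.col r a (m + 1) = j + 1 →
      (∀ x : ℕ → ℕ → k, TorusQuotient.CoordNeZero r a x →
        Φ (TorusQuotient.ratio r a x)
          (TorusQuotient.ratio r a (TorusQuotient.swapCols m x))) →
      TorusQuotient.ReflectionActs k n r a j Φ := fun hj hm hc hc' hΦ =>
    ha.reflectionActs hr1 _ (fun x _ => ha.simpleRefl_smul_swapCols h hj hm hc hc' x)
      fun x hx _ => hΦ x hx
  have hswapRows : ∀ {p : ℕ} {Φ : (Y sY : ℕ → ℕ → k) → Prop}, 1 ≤ p → p + 1 ≤ r →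
      a (p + 1) = a p + 1 →
      (∀ x : ℕ → ℕ → k, TorusQuotient.CoordNeZero r a x →
        Φ (TorusQuotient.ratio r a x)
          (TorusQuotient.ratio r a (TorusQuotient.swapRows p x))) →
      TorusQuotient.ReflectionActs k n r a (a (p + 1)) Φ := fun hp hpr hap hΦ =>
    ha.reflectionActs hr1 _ (fun x _ => ha.simpleRefl_smul_swapRows h hp hpr hap x)
      fun x hx _ => hΦ x hx
  -- Here the nonvanishing of the image coordinates is passed on, since the denominator in the
  -- formula for `i > p` depends on it.
  have hlower : ∀ {p : ℕ} {Φ : (Y sY : ℕ → ℕ → k) → Prop}, 1 ≤ p → p ≤ r →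
      (2 ≤ p → a (p - 1) + 2 ≤ a p) →
      (∀ x : ℕ → ℕ → k, TorusQuotient.CoordNeZero r a x →
        TorusQuotient.CoordNeZero r a (TorusQuotient.lowerPivot p (a p - p + 1) x) →
        Φ (TorusQuotient.ratio r a x)
          (TorusQuotient.ratio r a (TorusQuotient.lowerPivot p (a p - p + 1) x))) →
      TorusQuotient.ReflectionActs k n r a (a p) Φ := fun {p} _ hp hpr hap hΦ =>
    ha.reflectionActs hr1 _ (fun x hx => ha.simpleRefl_smul_lowerPivot h hp hpr hap
      (hx p _ hp hpr (by omega) le_rfl)) hΦ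
  refine ⟨?_, ?_, ?_, ?_, ?_, ?_, ?_⟩
  · intro j hj hja
    have h1 := ha.apply_lt 1 le_rfl hr1
    have hc := ha.col_eq (m := j) (p := 0) hj (by omega) (by omega) (fun _ => by
      show j < a 1 + 1
      omega)
    have hc' := ha.col_eq (m := j + 1) (p := 0) (by omega) (by omega) (by omega) (fun _ => by
      show j + 1 < a 1 + 1
      omega)
    refine hswapCols (m := j) (by omega) hj hc hc' fun x _ i hi hir => ?_
    have h2 := ha.apply_add_le 1 i le_rfl hi (by omega)
    obtain ⟨e1, e2, e3⟩ := TorusQuotient.ratio_swapCols_interchange (r := r) (a := a) hj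
      (by omega : j < a i - i) x
    exact ⟨e1, e2, fun l hl _ => e3 l hl⟩
  · intro p j hp hpr hj hja
    have h1 := ha.apply_lt (p + 1) (by omega) (by omega)
    have h2 := ha.le_apply p hp (by omega)
    have hc := ha.col_eq (m := j) (p := p) (by omega) (by omega) (by omega) (by omega)
    have hc' := ha.col_eq (m := j + 1) (p := p) (by omega) (by omega) (by omega) (by omega)
    rw [show j + 1 - p = j - p + 1 by omega] at hc'
    have hgt : ∀ i, p + 1 ≤ i → i ≤ r - 1 → j - p < a i - i := fun i hi hir => by
      have := ha.apply_add_le (p + 1) i (by omega) hi (by omega)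
      omega
    refine hswapCols (m := j - p) (by omega) (by omega) hc hc' fun x _ =>
      ⟨fun i hi hir => ?_, fun i l hi hir hl hla hil => ?_⟩
    · obtain ⟨e1, e2, -⟩ := TorusQuotient.ratio_swapCols_interchange (r := r) (by omega)
        (hgt i hi hir) x
      exact ⟨e1, e2⟩
    · rcases le_or_gt i p with hip | hip
      · have := ha.length_mono hi hip (by omega)
        exact TorusQuotient.ratio_swapCols_of_lt (by omega) x
      · exact (TorusQuotient.ratio_swapCols_interchange (by omega) (hgt i hip hir) x).2.2 l hl
          (by omega) (by omega)
  · intro p hp hpr hap1 hap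
    have h1 := ha.apply_lt p hp hpr
    have h2 : p + 1 ≤ a p := by
      rcases hp.lt_or_eq with hp' | rfl
      · have := ha.le_apply (p - 1) (by omega) (by omega)
        have := hap (by omega)
        omega
      · exact hap1 rfl
    have h3 : ∀ m, a p - 1 ≤ m → m ≤ a p → TorusQuotient.col r a (m - (p - 1)) = m :=
      fun m hm hm' => ha.col_eq (by omega) (by omega)
        (fun hp' => by
          have := hap (by omega)
          omega)
        (fun _ => by rw [Nat.sub_add_cancel hp]; omega)
    have hc := h3 (a p - 1) le_rfl (by omega)
    have hc' := h3 (a p) (by omega) le_rfl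
    rw [show a p - 1 - (p - 1) = a p - p by omega] at hc
    rw [show a p - (p - 1) = a p - p + 1 by omega] at hc'
    refine hswapCols (m := a p - p) (by omega) (by omega) hc (by omega) fun x hx =>
      ⟨fun i l hi hip _ _ => ?_, fun i hpi hir hai => ⟨?_, fun l hl hlp => ?_⟩,
        fun i hpi hir hai => ?_⟩
    · have := ha.length_mono hi hip (by omega)
      have := hap (by omega)
      exact TorusQuotient.ratio_swapCols_of_lt (by omega) x
    · exact TorusQuotient.ratio_swapCols_last (by omega) (by omega) (by omega) hai x
    · have := ha.length_mono (i := i) (j := i + 1) (by omega) (by omega) (by omega)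
      exact TorusQuotient.ratio_swapCols_of_lt_last (by omega) (by omega) hl hlp hai
        (hx _ _ (by omega) (by omega) (by omega) (by omega))
        (hx _ _ (by omega) (by omega) (by omega) (by omega))
    · obtain ⟨e1, e2, e3⟩ := TorusQuotient.ratio_swapCols_interchange (r := r) (by omega) hai x
      exact ⟨e1, e2, fun l hl _ => e3 l hl⟩
  · intro p hp hpr hap
    -- The exchanged columns are `p - 1` and `p`, so the lemmas on `swapRows` are used at `p - 1`.
    obtain ⟨q, rfl⟩ : ∃ q, p = q + 1 := ⟨p - 1, by omega⟩
    rw [Nat.add_sub_cancel] at hap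
    have hle := ha.le_apply q (by omega) (by omega)
    refine hswapRows (by omega) (by omega) hap fun x hx =>
      ⟨fun hq l hl hla => ?_, fun l hl hla => ⟨?_, ?_⟩, fun i l _ _ h1 h2 h3 _ _ => ?_⟩
    · rw [show q + 1 - 2 = q - 1 by omega] at hla ⊢
      have hle' := ha.le_apply (q - 1) (by omega) (by omega)
      rw [show a (q - 1) + 3 - (q + 1) = a (q - 1) - (q - 1) + 1 by omega]
      exact ha.ratio_swapRows_pred (by omega) (by omega) hap hl (by omega) hx
    · exact TorusQuotient.ratio_swapRows_self (by omega) (by omega) hl (by omega) x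
    · exact ha.ratio_swapRows_succ (by omega) (by omega) hap hl (by omega) hx
    · exact TorusQuotient.ratio_swapRows_of_ne (by omega) (by omega) (by omega) x
  · intro p hp hpr hap
    refine hlower hp (by omega) hap fun x hx hx' =>
      ⟨fun i l hi _ _ _ hil => ?_, fun l hl hla => ?_, fun i l hpi hir hl hla => ?_⟩
    · exact ha.ratio_lowerPivot_of_fixed hp (by omega) hap (by omega) hx
    · exact ha.ratio_lowerPivot_self hp (by omega) hl hla hx
    · have h1 : Finset.Icc p (i - 1) = Finset.Ico p i := by
        ext
        simp only [Finset.mem_Icc, Finset.mem_Ico]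
        omega
      have h2 : Finset.Icc p i = Finset.Ico p (i + 1) := by
        ext
        simp only [Finset.mem_Icc, Finset.mem_Ico]
        omega
      rw [h1, h2, ha.prod_ratio_div hp (by omega) (by omega) hl hla hx,
        ha.prod_ratio_div hp (by omega) (by omega) hl hla hx]
      exact ha.ratio_lowerPivot_of_gt hp hpi (by omega) hl hla hx hx'
  · intro hap
    obtain ⟨q, rfl⟩ : ∃ q, r = q + 1 := ⟨r - 1, by omega⟩
    rw [Nat.add_sub_cancel] at hap
    have hle := ha.le_apply q (by omega) (by omega)
    refine hswapRows (by omega) le_rfl hap fun x hx =>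
      ⟨fun hq l hl hla => ?_, fun l hl hla => ?_, fun i l _ _ h1 h2 _ _ => ?_⟩
    · rw [show q + 1 - 2 = q - 1 by omega] at hla ⊢
      have hle' := ha.le_apply (q - 1) (by omega) (by omega)
      rw [show a (q - 1) + 3 - (q + 1) = a (q - 1) - (q - 1) + 1 by omega]
      exact ha.ratio_swapRows_pred (by omega) (by omega) hap hl (by omega) hx
    · exact TorusQuotient.ratio_swapRows_self (by omega) (by omega) hl (by omega) x
    · exact TorusQuotient.ratio_swapRows_of_ne (by omega) (by omega) (by omega) x
  · intro hap
    refine hlower hr1 le_rfl (fun _ => hap) fun x hx _ i l hi hir hl hla => ?_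
    -- No column lies to the right of the last one, so only the fixed coordinates occur; those with
    -- `i = r` are `1` by convention.
    rcases hir.lt_or_eq with hir | rfl
    · exact ha.ratio_lowerPivot_of_fixed hr1 le_rfl (fun _ => hap) (Or.inl hir) hx
    · rw [TorusQuotient.ratio_eq_one (Or.inl le_rfl), TorusQuotient.ratio_eq_one (Or.inl le_rfl)]
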